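/- **Theorem (Black-box PIT for diagonal circuits).** Let $n,d\ge 1$ and $k,e\ge 0$ be integers and let $\mathbb{F}$ be a field of arbitrary characteristic. Let $\mathcal{DC}=\mathcal{DC}_{\mathbb F}(n,k,e,d)\subseteq\mathbb{F}[x_1,\dots,x_n]$ be the set of polynomials computed by diagonal depth-4 circuits, that is, of the form $$\Phi=\sum_{i=1}^{k}\ \prod_{j=1}^{r_i}P_{i,j}^{\,e_{i,j}},\qquad P_{i,j}=\sum_{m=1}^{n}g_{i,j,m}(x_m),$$ where $r_i, e_{i,j}\in\mathbb{N}$ are arbitrary subject to $|\vec e_i|_\times:=\prod_{j}(1+e_{i,j})\le e$ for every $i$, the $g_{i,j,m}$ are univariate polynomials over $\mathbb F$, and $\deg P_{i,j}\le d$ for all $i,j$. If $|\mathbb{F}|\ge(2ndk^3e^4)^2$, then $\mathcal{DC}$ has a $\mathrm{poly}(n,k,e,d)$-explicit hitting set of size at most $(2nd^2k^4e^6)^{\lceil\lg n\rceil+1}$. Here a set $\mathcal H\subseteq\mathbb F^n$ is a hitting set for $\mathcal{DC}$ if every $f\in\mathcal{DC}$ satisfies: $f=0$ as a polynomial if and only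 if $f$ vanishes at every point of $\mathcal H$. Explicitness means the following, uniformly in all parameters. There are a single program and a single polynomial $p$ with natural-number coefficients, both independent of $\mathbb F$ and of $n,k,e,d$, such that for every $\mathbb F$, $n,k,e,d$ as above and every enumeration of $\mathbb{F}$ (a sequence of elements of $\mathbb{F}$ whose first $|\mathbb F|$ terms, or all terms if $\mathbb F$ is infinite, are pairwise distinct) there is such a hitting set $\mathcal H=\{h_0,\dots,h_{N-1}\}$, with $N\le(2nd^2k^4e^6)^{\lceil\lg n\rceil+1}$ (repetitions among the $h_i$ being allowed), for which the program, given $(n,k,e,d,i)$ with $i<N$, outputs the point $h_i\in\mathbb F^n$ within $p(n,k,e,d)$ steps. Programs are while-programs on a random access machine with one memory for natural numbers and one for field elements. Operations on natural numbers are charged by bit length, each operation $+,-,\cdot,{}^{-1}$ or equality test in $\mathbb F$ costs one step, and reading the $i$-th term of the enumeration of $\mathbb F$ costs $i+1$ steps. -/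

import Mathlib

/-!  Diagonal depth-4 circuits, hitting sets, and a random access machine over a field. -/

/-- A diagonal depth-4 circuit `Φ = ∑_{i < k} ∏_j P_{i,j} ^ e_{i,j}` in `n` variables, where every
`P_{i,j} = ∑_m g_{i,j,m}(x_m)` is a sum of univariate polynomials. -/
structure DiagonalCircuit (F : Type*) [Field F] (n k : ℕ) where
  /-- the number of distinct factors of each product gate -/
  factors : Fin k → ℕ
  /-- the multiplicities `e_{i,j}` -/
  expo : (i : Fin k) → Fin (factors i) → ℕ
  /-- the univariate polynomials `g_{i,j,m}` -/
  g : (i : Fin k) → Fin (factors i) → Fin n → Polynomial F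

namespace DiagonalCircuit

variable {F : Type*} [Field F] {n k : ℕ}

/-- `P_{i,j} = ∑_m g_{i,j,m}(x_m)`. -/
noncomputable def P (Φ : DiagonalCircuit F n k) (i : Fin k) (j : Fin (Φ.factors i)) :
    MvPolynomial (Fin n) F :=
  ∑ m : Fin n, Polynomial.aeval (MvPolynomial.X m : MvPolynomial (Fin n) F) (Φ.g i j m)

/-- The polynomial computed by the circuit. -/
noncomputable def toPoly (Φ : DiagonalCircuit F n k) : MvPolynomial (Fin n) F :=
  ∑ i : Fin k, ∏ j : Fin (Φ.factors i), Φ.P i j ^ Φ.expo i j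

/-- `|e_i|_× = ∏_j (1 + e_{i,j})`. -/
def expoSize (Φ : DiagonalCircuit F n k) (i : Fin k) : ℕ :=
  ∏ j : Fin (Φ.factors i), (1 + Φ.expo i j)

end DiagonalCircuit

/-- The `n`-variate polynomials computed by diagonal depth-4 circuits with `k` product gates,
`|e_i|_× ≤ e` for all `i`, and `deg P_{i,j} ≤ d` for all `i, j`. -/
def diagonalClass (F : Type*) [Field F] (n k e d : ℕ) : Set (MvPolynomial (Fin n) F) :=
  {f | ∃ Φ : DiagonalCircuit F n k, (∀ i, Φ.expoSize i ≤ e) ∧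
    (∀ i j, (Φ.P i j).totalDegree ≤ d) ∧ f = Φ.toPoly}

/-- `H ⊆ F^n` is a hitting set for the class `C`: for `f ∈ C`, `f` is the zero polynomial if and
only if `f` vanishes on `H`. -/
def IsHittingSet {F : Type*} [Field F] {n : ℕ} (C : Set (MvPolynomial (Fin n) F))
    (H : Set (Fin n → F)) : Prop :=
  ∀ f ∈ C, f = 0 ↔ ∀ a ∈ H, MvPolynomial.eval a f = 0

/-- `enum 0, enum 1, …` lists distinct elements of `F`: the elements `enum i` with `i < |F|` are
pairwise distinct. So a finite field is listed exhaustively by its first `|F|` terms, and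
for an infinite field the sequence is injective. -/
def IsEnumeration {F : Type*} (enum : ℕ → F) : Prop :=
  Set.InjOn enum {i : ℕ | (i : ℕ∞) < ENat.card F}

/-! ### Random access machines over a field

A machine has two memories, each with cells indexed by `ℕ`: one holds natural numbers, the other
holds elements of the field. Programs are while-programs. Operations on natural numbers are charged
by bit length (logarithmic cost), a field operation or an equality test in the field is
charged `1`, and reading the `i`-th element of the enumeration of the field is charged `i + 1`
(beyond the evaluation of `i`). -/

namespace FieldRAM

/-- The memory of a machine. -/
structure State (F : Type*) where
  /-- the cells that hold natural numbers -/
  nat : ℕ → ℕ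
  /-- the cells that hold field elements -/
  fld : ℕ → F

/-- Binary operations on natural numbers; subtraction is truncated, and `x / 0 = 0`,
`x % 0 = x`. -/
inductive NOp where
  | add | sub | mul | div | mod

/-- The value of an operation. -/
def NOp.eval : NOp → ℕ → ℕ → ℕ
  | add, x, y => x + y
  | sub, x, y => x - y
  | mul, x, y => x * y
  | div, x, y => x / y
  | mod, x, y => x % y

/-- Expressions of natural-number value. `load a` reads the cell whose address is the value
of `a`. -/
inductive NExpr where
  | const (c : ℕ)
  | load (a : NExpr)
  | op (o : NOp) (a b : NExpr)

/-- Expressions with value in the field; `enum a` is the element of the enumeration of the field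
whose index is the value of `a`. -/
inductive FExpr where
  | zero
  | one
  | load (a : NExpr)
  | enum (a : NExpr)
  | add (x y : FExpr)
  | sub (x y : FExpr)
  | mul (x y : FExpr)
  | inv (x : FExpr)

/-- Tests. -/
inductive Test where
  | natEq (a b : NExpr)
  | natLt (a b : NExpr)
  | fldEq (x y : FExpr)

/-- Programs. -/
inductive Prog where
  | skip
  | setNat (a v : NExpr)
  | setFld (a : NExpr) (x : FExpr)
  | seq (p q : Prog)
  | cond (b : Test) (p q : Prog)
  | loop (b : Test) (p : Prog)

section Semantics

variable {F : Type*}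

/-- The value of an expression. -/
def NExpr.eval (s : State F) : NExpr → ℕ
  | const c => c
  | load a => s.nat (a.eval s)
  | op o a b => o.eval (a.eval s) (b.eval s)

/-- The cost of evaluating an expression; `Nat.size` is the bit length. -/
def NExpr.cost (s : State F) : NExpr → ℕ
  | const c => 1 + c.size
  | load a => a.cost s + (1 + (a.eval s).size + (s.nat (a.eval s)).size)
  | op _ a b => a.cost s + b.cost s + (1 + (a.eval s).size) * (1 + (b.eval s).size)

/-- The value of an expression, with `0⁻¹ = 0`. -/
def FExpr.eval [Field F] (enu : ℕ → F) (s : State F) : FExpr → F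
  | zero => 0
  | one => 1
  | load a => s.fld (a.eval s)
  | enum a => enu (a.eval s)
  | add x y => x.eval enu s + y.eval enu s
  | sub x y => x.eval enu s - y.eval enu s
  | mul x y => x.eval enu s * y.eval enu s
  | inv x => (x.eval enu s)⁻¹

/-- The cost of evaluating an expression. -/
def FExpr.cost (s : State F) : FExpr → ℕ
  | zero => 1
  | one => 1
  | load a => a.cost s + (1 + (a.eval s).size)
  | enum a => a.cost s + (1 + a.eval s)
  | add x y => x.cost s + y.cost s + 1
  | sub x y => x.cost s + y.cost s + 1
  | mul x y => x.cost s + y.cost s + 1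
  | inv x => x.cost s + 1

/-- The outcome of a test. -/
def Test.holds [Field F] (enu : ℕ → F) (s : State F) : Test → Prop
  | natEq a b => a.eval s = b.eval s
  | natLt a b => a.eval s < b.eval s
  | fldEq x y => x.eval enu s = y.eval enu s

/-- The cost of a test. -/
def Test.cost (s : State F) : Test → ℕ
  | natEq a b => a.cost s + b.cost s + (1 + (a.eval s).size + (b.eval s).size)
  | natLt a b => a.cost s + b.cost s + (1 + (a.eval s).size + (b.eval s).size)
  | fldEq x y => x.cost s + y.cost s + 1

/-- `Exec enu p s t s'`: the program `p`, started in the state `s`, halts in the state `s'` after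
`t` steps (total cost `t`), where the field is listed by `enu`. -/
inductive Exec [Field F] (enu : ℕ → F) : Prog → State F → ℕ → State F → Prop where
  | skip (s : State F) : Exec enu .skip s 1 s
  | setNat (a v : NExpr) (s : State F) :
      Exec enu (.setNat a v) s
        (a.cost s + v.cost s + (1 + (a.eval s).size + (v.eval s).size))
        { s with nat := Function.update s.nat (a.eval s) (v.eval s) }
  | setFld (a : NExpr) (x : FExpr) (s : State F) :
      Exec enu (.setFld a x) s
        (a.cost s + x.cost s + (1 + (a.eval s).size))
        { s with fld := Function.update s.fld (a.eval s) (x.eval enu s) }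
  | seq {p q : Prog} {s s₁ s₂ : State F} {t₁ t₂ : ℕ} :
      Exec enu p s t₁ s₁ → Exec enu q s₁ t₂ s₂ → Exec enu (.seq p q) s (t₁ + t₂) s₂
  | condTrue {b : Test} {p q : Prog} {s s' : State F} {t : ℕ} :
      b.holds enu s → Exec enu p s t s' → Exec enu (.cond b p q) s (b.cost s + 1 + t) s'
  | condFalse {b : Test} {p q : Prog} {s s' : State F} {t : ℕ} :
      ¬ b.holds enu s → Exec enu q s t s' → Exec enu (.cond b p q) s (b.cost s + 1 + t) s'
  | loopTrue {b : Test} {p : Prog} {s s₁ s₂ : State F} {t₁ t₂ : ℕ} :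
      b.holds enu s → Exec enu p s t₁ s₁ → Exec enu (.loop b p) s₁ t₂ s₂ →
      Exec enu (.loop b p) s (b.cost s + 1 + t₁ + t₂) s₂
  | loopFalse {b : Test} {p : Prog} {s : State F} :
      ¬ b.holds enu s → Exec enu (.loop b p) s (b.cost s + 1) s

/-- The initial state: the input numbers stand in the first natural-number cells, and every other
cell of either memory holds `0`. -/
def start [Field F] (input : List ℕ) : State F where
  nat := fun j => input.getD j 0
  fld := fun _ => 0

/-- On the given input, the program `p` halts within `T` steps with the vector `a` in the first
`n` field cells. -/
def Computes [Field F] {n : ℕ} (enu : ℕ → F) (p : Prog) (input : List ℕ) (a : Fin n → F)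
    (T : ℕ) : Prop :=
  ∃ (t : ℕ) (s : State F), Exec enu p (start input) t s ∧ t ≤ T ∧ ∀ j : Fin n, s.fld j = a j

end Semantics

end FieldRAM

/-! Attach to a circuit the vector of all subproducts `∏_j P_{i,j} ^ b_j` with `b_j ≤ e_{i,j}`. It
has at most `R = k * e` entries, and the circuit is a fixed linear functional of it. If the
variables are split into two halves, every `P_{i,j}` becomes a sum of two parts, and by the binomial
theorem the vector is a bilinear function of the vectors of the two halves (`subProd_add`). This
allows a construction along a binary tree on the variables: for each dyadic block, a curve whose
subproduct vectors span the vectors at all points of the block.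

At a leaf the curve is the variable itself. For a merge, the rank condenser
`finite_not_mem_span_eval` shows that for all but finitely many `α` the parameters `α * ω ^ m`, `m <
R`, already span what the whole curve spans. By bilinearity the `R * R` pairs of such parameters
span the merged block, and Lagrange interpolation lays the next curve through these pairs
(`exists_seed_forall_mem_span`). One `α` serves all blocks of a level, so `⌈lg n⌉` seed values and
the last curve parameter suffice. A functional that vanishes on the last curve vanishes everywhere,
so a nonzero circuit has a good seed over the algebraic closure (`exists_seed_aeval_ne_zero`).

In each seed coordinate separately the composed polynomial has degree less than `T = d * e * R ^ 2`.
The coordinates can thus be moved one by one into a fixed set of `T` elements of `F`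
(`exists_grid_seed_eval_ne_zero`), which leaves `T ^ (⌈lg n⌉ + 1)` points.

For explicitness, a suitable `ω` occurs among the first `T ^ 2 + 1` elements of the enumeration
(`exists_orderTest_ne_zero`). The program finds it, reads the index of the point in base `T` as a
seed, and tabulates the generator level by level. -/

/-! ### Rank condensers from geometric progressions -/

open Polynomial in
/-- Polynomials with pairwise distinct degrees have `K[X]`-linearly independent vectors of
geometric shifts. -/
theorem shift_combination_eq_zero {K : Type*} [Field K] {ρ T : ℕ} {ω : K}
    (hω : Set.InjOn (fun a : ℕ => ω ^ a) (Set.Iio T)) {u : Fin ρ → K[X]}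
    (hu0 : ∀ i, u i ≠ 0) (huT : ∀ i, (u i).natDegree < T)
    (hinj : Function.Injective fun i => (u i).natDegree) {c : Fin ρ → K[X]}
    (hc : ∀ m : Fin ρ, ∑ i, c i * (u i).comp (C (ω ^ (m : ℕ)) * X) = 0) : c = 0 := by
  classical
  by_contra hne
  obtain ⟨i₀, hi₀⟩ := Function.ne_iff.mp hne
  -- In the maximal total degree `M` only the leading term of `u i` contributes, and the shift by `ω
  -- ^ m` multiplies it by `(ω ^ deg (u i)) ^ m`. The ratios are distinct, so a Vandermonde argument
  -- kills every contribution, including that of `i₁`.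
  obtain ⟨i₁, hi₁, hmax⟩ := Finset.exists_max_image (Finset.univ.filter fun i => c i ≠ 0)
    (fun i => (c i).natDegree + (u i).natDegree) ⟨i₀, by simpa using hi₀⟩
  set M := (c i₁).natDegree + (u i₁).natDegree with hM
  have hi₁' : c i₁ ≠ 0 := by simpa using hi₁
  have hle : ∀ i, c i ≠ 0 → (c i).natDegree + (u i).natDegree ≤ M := fun i hi =>
    hmax i (by simpa using hi)
  have hcoeff : ∀ (i : Fin ρ) (m : ℕ), ((u i).comp (C (ω ^ m) * X)).coeff (u i).natDegree
      = (u i).leadingCoeff * (ω ^ (u i).natDegree) ^ m := by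
    intro i m
    rw [comp_C_mul_X_coeff, ← pow_mul, ← pow_mul, mul_comm m, leadingCoeff]
  have hdeg : ∀ (i : Fin ρ) (m : ℕ), ((u i).comp (C (ω ^ m) * X)).natDegree
      ≤ (u i).natDegree := by
    intro i m
    refine natDegree_comp_le.trans ?_
    calc _ ≤ (u i).natDegree * 1 := Nat.mul_le_mul_left _ (natDegree_C_mul_le _ _ |>.trans natDegree_X_le)
      _ = _ := mul_one _
  have hterm : ∀ (i : Fin ρ) (m : ℕ), (c i * (u i).comp (C (ω ^ m) * X)).coeff M
      = ((c i).coeff (M - (u i).natDegree) * (u i).leadingCoeff) *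
        (ω ^ (u i).natDegree) ^ m := by
    intro i m
    by_cases hci : c i = 0
    · simp [hci]
    have h1 := hle i hci
    have h2 : M = (M - (u i).natDegree) + (u i).natDegree := by omega
    rw [h2, coeff_mul_add_eq_of_natDegree_le (by omega) (hdeg i m), hcoeff, ← h2, mul_assoc]
  have hv := Matrix.eq_zero_of_forall_pow_sum_mul_pow_eq_zero
    (f := fun i : Fin ρ => ω ^ (u i).natDegree)
    (v := fun i => (c i).coeff (M - (u i).natDegree) * (u i).leadingCoeff)
    (fun a b hab => hinj (hω (huT a) (huT b) hab)) (fun m => by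
      have := congrArg (fun p => p.coeff M) (hc m)
      simpa only [finsetSum_coeff, hterm, coeff_zero] using this)
  have := congrFun hv i₁
  simp only [Pi.zero_apply, mul_eq_zero, leadingCoeff_eq_zero, hu0, or_false] at this
  rw [hM, Nat.add_sub_cancel] at this
  exact hi₁' (leadingCoeff_eq_zero.mp this)

open Polynomial in
/-- A space of polynomials of degree less than `T` and dimension at most `R` is spanned by at most
`R` polynomials of pairwise distinct degrees. -/
theorem exists_distinct_degree_span {K : Type*} [Field K] {T R : ℕ} {ω : K}
    (hω : Set.InjOn (fun a : ℕ => ω ^ a) (Set.Iio T)) (U : Submodule K K[X])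
    [FiniteDimensional K U] (hR : Module.finrank K U ≤ R) (hT : ∀ u ∈ U, u ≠ 0 → u.natDegree < T) :
    ∃ ρ ≤ R, ∃ u : Fin ρ → K[X], (∀ i, u i ∈ U) ∧ (∀ i, u i ≠ 0) ∧
      (Function.Injective fun i => (u i).natDegree) ∧ ∀ v ∈ U, v ∈ Submodule.span K (Set.range u) := by
  classical
  -- One polynomial is kept for each degree attained in `U`. Independence bounds their number by the
  -- dimension; cancelling leading terms shows that they span.
  set E := (Finset.range T).filter fun δ => ∃ v ∈ U, v ≠ 0 ∧ v.natDegree = δ with hE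
  have hmem : ∀ δ : E, ∃ v ∈ U, v ≠ 0 ∧ v.natDegree = δ := fun δ => (Finset.mem_filter.mp δ.2).2
  choose w hwU hw0 hwd using hmem
  set u : Fin E.card → K[X] := fun i => w (E.equivFin.symm i) with hu
  have hinj : Function.Injective fun i => (u i).natDegree := by
    intro a b hab
    simp only [hu, hwd] at hab
    exact E.equivFin.symm.injective (Subtype.ext hab)
  have hli : LinearIndependent K u := by
    rw [Fintype.linearIndependent_iff]
    intro g hg
    have := shift_combination_eq_zero hω (fun i => hw0 _) (fun i => hT _ (hwU _) (hw0 _)) hinj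
      (c := fun i => C (g i)) (fun m => by
        have := congrArg (fun p => p.comp (C (ω ^ (m : ℕ)) * X)) hg
        simpa [smul_eq_C_mul, sum_comp] using this)
    exact fun i => C_eq_zero.mp (congrFun this i)
  have hli' : LinearIndependent K (fun i => (⟨u i, hwU _⟩ : U)) :=
    LinearIndependent.of_comp U.subtype hli
  refine ⟨E.card, ?_, u, fun i => hwU _, fun i => hw0 _, hinj, ?_⟩
  · simpa using hli'.fintype_card_le_finrank.trans hR
  · intro v hv
    induction hN : v.natDegree using Nat.strong_induction_on generalizing v with
    | _ N ih =>
      by_cases hv0 : v = 0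
      · simp [hv0]
      have hmE : v.natDegree ∈ E :=
        Finset.mem_filter.mpr ⟨Finset.mem_range.mpr (hT v hv hv0), v, hv, hv0, rfl⟩
      set b := w ⟨_, hmE⟩ with hb
      have hbs : b ∈ Submodule.span K (Set.range u) :=
        Submodule.subset_span ⟨E.equivFin ⟨_, hmE⟩, by simp [hu, hb]⟩
      have hbd : b.natDegree = v.natDegree := hwd _
      have hb0 : b.leadingCoeff ≠ 0 := leadingCoeff_ne_zero.mpr (hw0 _)
      set r := v - (v.leadingCoeff / b.leadingCoeff) • b with hr
      have hrU : r ∈ U := U.sub_mem hv (U.smul_mem _ (hwU _))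
      have hvr : v = r + (v.leadingCoeff / b.leadingCoeff) • b := by simp [hr]
      have hrs : r ∈ Submodule.span K (Set.range u) := by
        by_cases hr0 : r = 0
        · simp [hr0]
        have hco : r.coeff v.natDegree = 0 := by
          have : b.coeff v.natDegree = b.leadingCoeff := by rw [leadingCoeff, hbd]
          simp [hr, this, hb0]
        have hrd : r.natDegree ≤ v.natDegree := by
          refine (natDegree_sub_le _ _).trans (max_le le_rfl ?_)
          exact (natDegree_smul_le _ _).trans hbd.le
        have hlt : r.natDegree < v.natDegree := by
          refine lt_of_le_of_ne hrd fun h => hr0 (leadingCoeff_eq_zero.mp ?_)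
          rw [leadingCoeff, h, hco]
        exact ih _ (hN ▸ hlt) r hrU rfl
      rw [hvr]
      exact Submodule.add_mem _ hrs (Submodule.smul_mem _ _ hbs)

open Polynomial in
/-- Seeded rank condenser: for all but finitely many `α`, the values of a vector of polynomials at
a short geometric progression starting in `α` span all its values. -/
theorem finite_not_mem_span_eval {K ι : Type*} [Field K] [Fintype ι] {T R : ℕ} {ω : K}
    (hω : Set.InjOn (fun a : ℕ => ω ^ a) (Set.Iio T)) (h : ι → K[X])
    (hT : ∀ i, (h i).natDegree < T) (hR : Fintype.card ι ≤ R) :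
    {α : K | ¬ ∀ t : K, (fun i => (h i).eval t) ∈
      Submodule.span K {x | ∃ m < R, x = fun i => (h i).eval (α * ω ^ m)}}.Finite := by
  classical
  set U := Submodule.span K (Set.range h) with hU
  have : FiniteDimensional K U := FiniteDimensional.span_of_finite K (Set.finite_range h)
  have hUR : Module.finrank K U ≤ R := (finrank_range_le_card h).trans hR
  have hUT : ∀ u ∈ U, u ≠ 0 → u.natDegree < T := by
    intro u hu hu0
    rcases Nat.eq_zero_or_pos T with rfl | hTpos
    · have : IsEmpty ι := ⟨fun i => absurd (hT i) (by simp)⟩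
      rw [hU, Set.range_eq_empty, Submodule.span_empty] at hu
      exact absurd hu hu0
    have hle : U ≤ degreeLT K T := Submodule.span_le.mpr (by
      rintro _ ⟨i, rfl⟩
      exact mem_degreeLT.mpr (degree_le_natDegree.trans_lt (by exact_mod_cast hT i)))
    exact (natDegree_lt_iff_degree_lt hu0).mpr (mem_degreeLT.mp (hle hu))
  obtain ⟨ρ, hρ, u, huU, hu0, hinj, hspan⟩ := exists_distinct_degree_span hω U hUR hUT
  set A : Matrix (Fin ρ) (Fin ρ) K[X] := fun m i => (u i).comp (C (ω ^ (m : ℕ)) * X) with hA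
  -- A kernel vector over `K[X]` would be a vanishing combination of all the shifts. The exceptional
  -- `α` are therefore among the roots of `det A`.
  have hdet : A.det ≠ 0 := by
    intro h0
    obtain ⟨c, hc0, hc⟩ := Matrix.exists_mulVec_eq_zero_iff.mpr h0
    refine hc0 (shift_combination_eq_zero hω hu0 (fun i => hUT _ (huU i) (hu0 i)) hinj fun m => ?_)
    have := congrFun hc m
    simpa [Matrix.mulVec, dotProduct, hA, mul_comm] using this
  refine (A.det.roots.toFinset.finite_toSet).subset fun α hα => ?_
  by_contra hroot
  have hev : A.det.eval α ≠ 0 := fun h0 => hroot (by simp [hdet, h0])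
  apply hα
  intro t
  by_contra hnot
  -- A functional `f` that separates a value from the span gives `p = f ∘ h` in `U` with zeros along
  -- the progression. Its coordinates in the basis `u` lie in the kernel of the invertible matrix
  -- `A(α)`, so `p = 0`, against the choice of `f`.
  obtain ⟨f, hft, hker⟩ := Submodule.exists_le_ker_of_notMem hnot
  set p : K[X] := ∑ i, f (Pi.single i 1) • h i with hp
  have hfe : ∀ s : K, f (fun i => (h i).eval s) = p.eval s := by
    intro s
    rw [hp, LinearMap.pi_apply_eq_sum_univ f, eval_finsetSum]
    refine Finset.sum_congr rfl fun i _ => ?_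
    rw [eval_smul, smul_eq_mul, smul_eq_mul, mul_comm]
    congr 2
    ext j
    simp [Pi.single_apply, eq_comm]
  have hpU : p ∈ U := Submodule.sum_mem _ fun i _ =>
    Submodule.smul_mem _ _ (Submodule.subset_span ⟨i, rfl⟩)
  obtain ⟨g, hg⟩ := (Submodule.mem_span_range_iff_exists_fun K).mp (hspan p hpU)
  have hzero : ∀ m < R, p.eval (α * ω ^ m) = 0 := fun m hm => by
    rw [← hfe]
    exact LinearMap.mem_ker.mp (hker (Submodule.subset_span ⟨m, hm, rfl⟩))
  have hg0 : g = 0 := by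
    by_contra hne
    have : (A.map (eval α)).det = 0 := by
      refine Matrix.exists_mulVec_eq_zero_iff.mp ⟨g, hne, ?_⟩
      ext m
      have := hzero m (m.2.trans_le hρ)
      rw [← hg, eval_finsetSum] at this
      change ∑ x, eval α (A m x) * g x = 0
      simpa [hA, mul_comm] using this
    apply hev
    rw [← this, ← coe_evalRingHom, RingHom.map_det]
    rfl
  apply hft
  rw [hfe, ← hg, hg0]
  simp

/-! ### The interpolated curves -/

section Generator

variable {F B B' : Type*} [Field F] [CommRing B] [Algebra F B] [CommRing B'] [Algebra F B']

/-- The `q`-th Lagrange basis polynomial of the nodes `β 0, …, β (Q - 1)`, evaluated at `t`. -/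
def lagrangeBasis (Q : ℕ) (β : ℕ → F) (q : ℕ) (t : B) : B :=
  ∏ u ∈ Finset.range Q, if u = q then 1 else
    (t - algebraMap F B (β u)) * algebraMap F B ((β q - β u)⁻¹)

/-- The digit of `q` in base `R` that is selected by the `j`-th bit of `i`. -/
def digitSelect (R j i q : ℕ) : ℕ := q / (1 + (R - 1) * (i / 2 ^ j % 2)) % R

/-- The `i`-th coordinate of the level `j` generator with seed `α 0, …, α (j - 1), t`. -/
def generator (R : ℕ) (β : ℕ → F) (ω : F) (α : ℕ → B) : ℕ → ℕ → B → B
  | 0, _, t => t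
  | j + 1, i, t => ∑ q ∈ Finset.range (R * R), lagrangeBasis (R * R) β q t *
      generator R β ω α j i (α j * algebraMap F B (ω ^ digitSelect R j i q))

theorem map_lagrangeBasis (φ : B →ₐ[F] B') (Q : ℕ) (β : ℕ → F) (q : ℕ) (t : B) :
    φ (lagrangeBasis Q β q t) = lagrangeBasis Q β q (φ t) := by
  simp only [lagrangeBasis, map_prod]
  refine Finset.prod_congr rfl fun u _ => ?_
  split_ifs
  · exact map_one φ
  · rw [map_mul, map_sub, φ.commutes, φ.commutes]

theorem map_generator (φ : B →ₐ[F] B') (R : ℕ) (β : ℕ → F) (ω : F) (α : ℕ → B) (j i : ℕ) (t : B) :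
    φ (generator R β ω α j i t) = generator R β ω (fun v => φ (α v)) j i (φ t) := by
  induction j generalizing t with
  | zero => rfl
  | succ j ih =>
    simp only [generator, map_sum, map_mul, map_lagrangeBasis, ih, φ.commutes]

theorem generator_congr (R : ℕ) (β : ℕ → F) (ω : F) {α α' : ℕ → B} (j i : ℕ)
    (h : ∀ v < j, α v = α' v) (t : B) :
    generator R β ω α j i t = generator R β ω α' j i t := by
  induction j generalizing t with
  | zero => rfl
  | succ j ih =>
    simp only [generator, h j j.lt_succ_self, ih fun v hv => h v (hv.trans j.lt_succ_self)]

theorem lagrangeBasis_node {Q : ℕ} {β : ℕ → F} (hβ : Set.InjOn β (Set.Iio Q)) {q q' : ℕ}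
    (hq : q < Q) (hq' : q' < Q) :
    lagrangeBasis Q β q (algebraMap F B (β q')) = if q = q' then 1 else 0 := by
  split_ifs with h
  · subst h
    refine Finset.prod_eq_one fun u hu => ?_
    split_ifs with huq
    · rfl
    · have : β q - β u ≠ 0 := sub_ne_zero.mpr fun h =>
        huq (hβ hq (Finset.mem_range.mp hu) h).symm
      rw [← map_sub, ← map_mul, mul_inv_cancel₀ this, map_one]
  · refine Finset.prod_eq_zero (Finset.mem_range.mpr hq') ?_
    rw [if_neg (Ne.symm h), sub_self, zero_mul]

/-- At a node the Lagrange sum collapses to one term: the new curve passes through each chosen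
combination of points of the old curve. -/
theorem generator_succ_node {R : ℕ} {β : ℕ → F} (hβ : Set.InjOn β (Set.Iio (R * R))) (ω : F)
    (α : ℕ → B) (j i : ℕ) {q : ℕ} (hq : q < R * R) :
    generator R β ω α (j + 1) i (algebraMap F B (β q)) =
      generator R β ω α j i (α j * algebraMap F B (ω ^ digitSelect R j i q)) := by
  rw [generator, Finset.sum_eq_single_of_mem q (Finset.mem_range.mpr hq)]
  · rw [lagrangeBasis_node hβ hq hq, if_pos rfl, one_mul]
  · intro q' hq' hne
    rw [lagrangeBasis_node hβ (Finset.mem_range.mp hq') hq, if_neg hne, zero_mul]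

/-- A node number `m * R + m'` encodes a pair. The divisor in `digitSelect` is `1` or `R` according
to the bit, so variables in the left half of a block follow `m'` and those in the right half follow
`m`. -/
theorem digitSelect_of_even {R j i m m' : ℕ} (hm' : m' < R) (h : i / 2 ^ j % 2 = 0) :
    digitSelect R j i (m * R + m') = m' := by
  rw [digitSelect, h, mul_zero, add_zero, Nat.div_one, mul_comm, Nat.mul_add_mod, Nat.mod_eq_of_lt hm']

theorem digitSelect_of_odd {R j i m m' : ℕ} (hm : m < R) (hm' : m' < R) (h : i / 2 ^ j % 2 = 1) :
    digitSelect R j i (m * R + m') = m := by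
  have hR : 1 + (R - 1) * 1 = R := by omega
  rw [digitSelect, h, hR, mul_comm, Nat.mul_add_div (by omega), Nat.div_eq_of_lt hm', add_zero,
    Nat.mod_eq_of_lt hm]

open Polynomial in
theorem natDegree_lagrangeBasis_le {K : Type*} [Field K] [Algebra F K] (Q : ℕ) (β : ℕ → F) (q : ℕ)
    {t : K[X]} {δ : ℕ} (ht : t.natDegree ≤ δ) : (lagrangeBasis Q β q t).natDegree ≤ Q * δ := by
  refine (natDegree_prod_le _ _).trans ?_
  refine (Finset.sum_le_card_nsmul _ _ δ fun u _ => ?_).trans (by simp)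
  split_ifs
  · simp
  · rw [IsScalarTower.algebraMap_apply F K K[X], IsScalarTower.algebraMap_apply F K K[X],
      algebraMap_eq]
    refine (natDegree_mul_C_le _ _).trans ((natDegree_sub_le _ _).trans ?_)
    simpa using ht

open Polynomial in
/-- As a polynomial in one seed variable, every coordinate of the generator has degree at most
the number of nodes. -/
theorem natDegree_generator_le {K : Type*} [Field K] [Algebra F K] {R : ℕ} (hR : 0 < R)
    (β : ℕ → F) (ω : F) (α : ℕ → K[X]) (u : ℕ) (hu : (α u).natDegree ≤ 1)
    (hα : ∀ v, v ≠ u → (α v).natDegree = 0) (j i : ℕ) (s : F) :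
    (generator R β ω α j i (α j * algebraMap F K[X] s)).natDegree ≤
      if j < u then 0 else R * R := by
  have hmul : ∀ (v : ℕ) (s : F), (α v * algebraMap F K[X] s).natDegree ≤ (α v).natDegree := by
    intro v s
    rw [IsScalarTower.algebraMap_apply F K K[X], algebraMap_eq]
    exact natDegree_mul_C_le _ _
  have hRR : 1 ≤ R * R := Nat.mul_pos hR hR
  induction j generalizing s with
  | zero =>
    refine (hmul 0 s).trans ?_
    split_ifs with h
    · exact (hα 0 (by omega)).le
    · obtain rfl : u = 0 := by omega
      exact hu.trans hRR
  | succ j ih =>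
    rw [generator]
    refine natDegree_sum_le_of_forall_le _ _ fun q _ => natDegree_mul_le.trans ?_
    have h2 := ih (ω ^ digitSelect R j i q)
    -- The variable enters with positive degree in only one factor: in the Lagrange factor if `j + 1
    -- = u`, when the lower levels do not contain it, and otherwise at most in the lower levels.
    -- Hence degrees do not multiply along the recursion.
    by_cases hju : j + 1 = u
    · have h1 := natDegree_lagrangeBasis_le (R * R) β q ((hmul (j + 1) s).trans (hju ▸ hu))
      rw [if_pos (by omega)] at h2
      rw [if_neg (by omega)]
      omega
    · have h1 := natDegree_lagrangeBasis_le (R * R) β q ((hmul (j + 1) s).trans (hα _ hju).le)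
      split_ifs at h2 ⊢ <;> omega

end Generator

/-! ### Vectors of subproducts on dyadic blocks -/

namespace DiagonalCircuit

variable {F : Type*} [Field F] {n k : ℕ} (Φ : DiagonalCircuit F n k)

/-- The product gates together with a choice of multiplicities below the given ones. -/
abbrev SubExpo : Type := Σ i : Fin k, (j : Fin (Φ.factors i)) → Fin (Φ.expo i j + 1)

theorem card_subExpo : Fintype.card Φ.SubExpo = ∑ i, Φ.expoSize i := by
  simp [SubExpo, expoSize, add_comm]

variable {Φ} in
/-- The vector of all subproducts `∏_j a_{i,j} ^ b_j`. -/
def subProd {B : Type*} [CommSemiring B] (a : (i : Fin k) → Fin (Φ.factors i) → B)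
    (b : Φ.SubExpo) : B :=
  ∏ j, a b.1 j ^ (b.2 j : ℕ)

/-- The univariate polynomials of the circuit, extended by `0` to all variables indexed by `ℕ`. -/
noncomputable def gExt (i : Fin k) (j : Fin (Φ.factors i)) (m : ℕ) : Polynomial F :=
  if h : m < n then Φ.g i j ⟨m, h⟩ else 0

/-- The part of the sums `P_{i,j}` with variables in the `c`-th dyadic block of level `l`. -/
noncomputable def blockSum {B : Type*} [CommRing B] [Algebra F B] (l c : ℕ) (x : ℕ → B)
    (i : Fin k) (j : Fin (Φ.factors i)) : B :=
  ∑ m ∈ Finset.Ico (c * 2 ^ l) ((c + 1) * 2 ^ l), Polynomial.aeval (x m) (Φ.gExt i j m)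

theorem blockSum_succ {B : Type*} [CommRing B] [Algebra F B] (l c : ℕ) (x : ℕ → B) :
    Φ.blockSum (l + 1) c x =
      fun i j => Φ.blockSum l (2 * c) x i j + Φ.blockSum l (2 * c + 1) x i j := by
  funext i j
  simp only [blockSum]
  rw [Finset.sum_Ico_consecutive _ (by gcongr; omega) (by gcongr; omega)]
  congr 2 <;> ring

theorem blockSum_congr {B : Type*} [CommRing B] [Algebra F B] {l c : ℕ} {x y : ℕ → B}
    (h : ∀ m, m / 2 ^ l = c → x m = y m) : Φ.blockSum l c x = Φ.blockSum l c y := by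
  funext i j
  refine Finset.sum_congr rfl fun m hm => ?_
  rw [Finset.mem_Ico] at hm
  rw [h m (Nat.div_eq_of_lt_le hm.1 hm.2)]

theorem map_blockSum {B B' : Type*} [CommRing B] [Algebra F B] [CommRing B'] [Algebra F B']
    (φ : B →ₐ[F] B') (l c : ℕ) (x : ℕ → B) (i : Fin k) (j : Fin (Φ.factors i)) :
    φ (Φ.blockSum l c x i j) = Φ.blockSum l c (fun m => φ (x m)) i j := by
  simp only [blockSum, map_sum, Polynomial.aeval_algHom_apply]

variable {Φ} in
theorem map_subProd {B B' : Type*} [CommRing B] [Algebra F B] [CommRing B'] [Algebra F B']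
    (φ : B →ₐ[F] B') (a : (i : Fin k) → Fin (Φ.factors i) → B) (b : Φ.SubExpo) :
    φ (subProd a b) = subProd (fun i j => φ (a i j)) b := by
  simp only [subProd, map_prod, map_pow]

/-- The binomial convolution of vectors of subproducts. -/
def binomConv (K : Type*) [Field K] :
    (Φ.SubExpo → K) →ₗ[K] (Φ.SubExpo → K) →ₗ[K] (Φ.SubExpo → K) :=
  LinearMap.mk₂ K (fun v w b => ∑ f : (j : Fin (Φ.factors b.1)) → Fin (Φ.expo b.1 j + 1),
      -- `f` ranges over all exponents, not only those below `b`; where `f j` exceeds `b.2 j` the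
      -- binomial coefficient is `0`, so the truncated subtraction does no harm.
      (∏ j, ((b.2 j : ℕ).choose (f j) : K)) *
        (v ⟨b.1, f⟩ * w ⟨b.1, fun j => ⟨b.2 j - f j, by omega⟩⟩))
    (fun v v' w => by ext b; simp [add_mul, mul_add, Finset.sum_add_distrib])
    (fun a v w => by
      ext b
      simp only [Pi.smul_apply, smul_eq_mul, Finset.mul_sum]
      exact Finset.sum_congr rfl fun _ _ => by ring)
    (fun v w w' => by ext b; simp [mul_add, Finset.sum_add_distrib])
    (fun a v w => by
      ext b
      simp only [Pi.smul_apply, smul_eq_mul, Finset.mul_sum]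
      exact Finset.sum_congr rfl fun _ _ => by ring)

theorem add_pow_eq_sum_fin {K : Type*} [CommSemiring K] (x y : K) {b E : ℕ} (hb : b ≤ E) :
    (x + y) ^ b = ∑ f : Fin (E + 1), (b.choose f : K) * (x ^ (f : ℕ) * y ^ (b - f)) := by
  rw [add_pow, Fin.sum_univ_eq_sum_range (fun f => (b.choose f : K) * (x ^ f * y ^ (b - f)))]
  rw [← Finset.sum_subset (Finset.range_mono (Nat.succ_le_succ hb))]
  · exact Finset.sum_congr rfl fun _ _ => by ring
  · intro f _ hf
    rw [Nat.choose_eq_zero_of_lt (by simpa using hf), Nat.cast_zero, zero_mul]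

/-- Expanding each power of a sum produces only smaller exponents on both sides. This is why all
subproducts are recorded and not just the product gates. -/
theorem subProd_add {K : Type*} [Field K] (a a' : (i : Fin k) → Fin (Φ.factors i) → K) :
    (subProd (fun i j => a i j + a' i j) : Φ.SubExpo → K) =
      Φ.binomConv K (subProd a) (subProd a') := by
  funext b
  simp only [subProd, binomConv, LinearMap.mk₂_apply]
  simp_rw [fun j => add_pow_eq_sum_fin (a b.1 j) (a' b.1 j) (Nat.le_of_lt_succ (b.2 j).2)]
  rw [Finset.prod_univ_sum, Fintype.piFinset_univ]
  simp only [Finset.prod_mul_distrib]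

-- The hypothesis only bounds the sums `P i j`, but setting all other variables to `0` leaves the
-- single summand up to a constant.
open Polynomial in
theorem natDegree_gExt_le {d : ℕ} (h : ∀ i j, (Φ.P i j).totalDegree ≤ d) (i : Fin k)
    (j : Fin (Φ.factors i)) (m : ℕ) : (Φ.gExt i j m).natDegree ≤ d := by
  unfold gExt
  split_ifs with hm
  · have h1 := MvPolynomial.aeval_natDegree_le (n := 1) _ (h i j)
      (fun m' => if m' = (⟨m, hm⟩ : Fin n) then (X : F[X]) else 0)
      (fun m' => by split_ifs <;> simp)
    have h2 : MvPolynomial.aeval (fun m' => if m' = (⟨m, hm⟩ : Fin n) then (X : F[X]) else 0)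
        (Φ.P i j) = Φ.g i j ⟨m, hm⟩ +
          C (∑ m' ∈ Finset.univ.erase (⟨m, hm⟩ : Fin n), (Φ.g i j m').eval 0) := by
      rw [P, map_sum, ← Finset.add_sum_erase _ _ (Finset.mem_univ (⟨m, hm⟩ : Fin n)), map_sum]
      congr 1
      · rw [← Polynomial.aeval_algHom_apply]
        simp
      · refine Finset.sum_congr rfl fun m' hm' => ?_
        rw [← Polynomial.aeval_algHom_apply, MvPolynomial.aeval_X,
          if_neg (Finset.ne_of_mem_erase hm')]
        simp [aeval_def, eval₂_at_zero, coeff_zero_eq_eval_zero]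
    rw [h2, natDegree_add_C, mul_one] at h1
    exact h1
  · simp

/-- Expanding the product gives `1 + ∑ e_j ≤ ∏ (1 + e_j)`. The spare `1` makes the degree bound
below strict, so that `T` interpolation points are enough. -/
theorem sum_lt_of_expoSize_le {e : ℕ} (h : ∀ i, Φ.expoSize i ≤ e) (b : Φ.SubExpo) :
    ∑ j, (b.2 j : ℕ) < e := by
  refine lt_of_lt_of_le ?_ (h b.1)
  have h1 : ∑ j, (b.2 j : ℕ) ≤ ∑ j, Φ.expo b.1 j :=
    Finset.sum_le_sum fun j _ => Nat.le_of_lt_succ (b.2 j).2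
  have h2 : ∀ s : Finset (Fin (Φ.factors b.1)),
      1 + ∑ j ∈ s, Φ.expo b.1 j ≤ ∏ j ∈ s, (1 + Φ.expo b.1 j) := by
    intro s
    induction s using Finset.cons_induction with
    | empty => simp
    | cons a s ha ih =>
      rw [Finset.sum_cons, Finset.prod_cons]
      nlinarith [Nat.mul_le_mul_left (Φ.expo b.1 a) (show 1 ≤ ∏ j ∈ s, (1 + Φ.expo b.1 j) by omega)]
  have := h2 Finset.univ
  rw [expoSize]
  omega

open Polynomial in
theorem natDegree_subProd_blockSum_lt {K : Type*} [Field K] [Algebra F K] {e d N : ℕ}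
    (he : ∀ i, Φ.expoSize i ≤ e) (hd : ∀ i j, (Φ.P i j).totalDegree ≤ d) (hdN : 0 < d * N)
    (l c : ℕ) {x : ℕ → K[X]} (hx : ∀ m, (x m).natDegree ≤ N) (b : Φ.SubExpo) :
    (subProd (Φ.blockSum l c x) b).natDegree < d * e * N := by
  have h1 : ∀ i j, (Φ.blockSum l c x i j).natDegree ≤ d * N := by
    intro i j
    refine natDegree_sum_le_of_forall_le _ _ fun m _ => ?_
    rw [← aeval_map_algebraMap K, ← comp_eq_aeval]
    refine natDegree_comp_le.trans (Nat.mul_le_mul ?_ (hx m))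
    exact natDegree_map_le.trans (Φ.natDegree_gExt_le hd i j m)
  calc _ ≤ ∑ j, (Φ.blockSum l c x b.1 j ^ (b.2 j : ℕ)).natDegree := natDegree_prod_le _ _
    _ ≤ ∑ j, (b.2 j : ℕ) * (d * N) := Finset.sum_le_sum fun j _ =>
        natDegree_pow_le.trans (Nat.mul_le_mul_left _ (h1 _ _))
    _ = (∑ j, (b.2 j : ℕ)) * (d * N) := (Finset.sum_mul ..).symm
    _ < e * (d * N) := Nat.mul_lt_mul_of_pos_right (Φ.sum_lt_of_expoSize_le he b) hdN
    _ = d * e * N := by ring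

/-- Block `0` of level `l` contains every variable, the padding variables contribute `0`, and
`Fin.last` selects the full multiplicities. -/
theorem aeval_toPoly {B : Type*} [CommRing B] [Algebra F B] {l : ℕ} (hl : n ≤ 2 ^ l) (x : ℕ → B) :
    MvPolynomial.aeval (fun m : Fin n => x m) Φ.toPoly =
      ∑ i, subProd (Φ.blockSum l 0 x) ⟨i, fun _ => Fin.last _⟩ := by
  simp only [toPoly, map_sum, map_prod, map_pow, subProd, Fin.val_last]
  refine Finset.sum_congr rfl fun i _ => Finset.prod_congr rfl fun j _ => ?_
  congr 1
  simp only [P, map_sum, blockSum, zero_mul, zero_add, one_mul, ← Finset.range_eq_Ico]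
  rw [← Finset.sum_subset (Finset.range_mono hl), Finset.sum_range]
  · refine Finset.sum_congr rfl fun m _ => ?_
    rw [← Polynomial.aeval_algHom_apply, MvPolynomial.aeval_X, gExt, dif_pos m.2]
  · intro m _ hm
    rw [gExt, dif_neg (by simpa using hm), map_zero]

end DiagonalCircuit

/-! ### The generator spans, and hence hits -/

namespace DiagonalCircuit

variable {F : Type*} [Field F] {n k : ℕ} (Φ : DiagonalCircuit F n k)

open Polynomial in
theorem finite_not_mem_span_generator {K : Type*} [Field K] [Algebra F K] {e d R : ℕ}
    (he : ∀ i, Φ.expoSize i ≤ e) (hd : ∀ i j, (Φ.P i j).totalDegree ≤ d) (hR0 : 0 < R)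
    (hd0 : 0 < d) (hR : Fintype.card Φ.SubExpo ≤ R) {β : ℕ → F} {ω : F}
    (hω : Set.InjOn (fun a : ℕ => ω ^ a) (Set.Iio (d * e * (R * R)))) (α : ℕ → K) (l c : ℕ) :
    {a : K | ¬ ∀ t : K, subProd (Φ.blockSum l c fun i => generator R β ω α l i t) ∈
      Submodule.span K {y | ∃ m < R, y = subProd (Φ.blockSum l c fun i =>
        generator R β ω α l i (a * algebraMap F K (ω ^ m)))}}.Finite := by
  have hω' : Set.InjOn (fun a : ℕ => (algebraMap F K ω) ^ a) (Set.Iio (d * e * (R * R))) := by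
    intro a ha b hb hab
    simp only [← map_pow] at hab
    exact hω ha hb ((algebraMap F K).injective hab)
  -- Level `l` only uses the seeds below `l`. Slot `l` is free to hold the curve parameter, so the
  -- degree bound for seed coordinates covers it too.
  set α' : ℕ → K[X] := Function.update (fun v => C (α v)) l X with hα'
  have hl : α' l = X := Function.update_self ..
  have hgen : ∀ i, (generator R β ω α' l i (X : K[X])).natDegree ≤ R * R := by
    intro i
    have := natDegree_generator_le hR0 β ω α' l (by rw [hl]; exact natDegree_X_le)
      (fun v hv => by rw [hα', Function.update_of_ne hv, natDegree_C]) l i 1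
    rwa [map_one, mul_one, hl, if_neg (lt_irrefl l)] at this
  have key := finite_not_mem_span_eval (R := R) hω'
    (fun b : Φ.SubExpo => subProd (Φ.blockSum l c fun i => generator R β ω α' l i (X : K[X])) b)
    (fun b => Φ.natDegree_subProd_blockSum_lt he hd
      (Nat.mul_pos hd0 (Nat.mul_pos hR0 hR0)) l c hgen b) hR
  have hev : ∀ t : K, (fun b : Φ.SubExpo => (subProd (Φ.blockSum l c fun i =>
      generator R β ω α' l i (X : K[X])) b).eval t) =
      subProd (Φ.blockSum l c fun i => generator R β ω α l i t) := by
    intro t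
    funext b
    have h1 := map_subProd ((aeval (R := K) t).restrictScalars F)
      (Φ.blockSum l c fun i => generator R β ω α' l i (X : K[X])) b
    simp only [map_blockSum, map_generator, AlgHom.coe_restrictScalars', coe_aeval_eq_eval,
      eval_X] at h1
    have hx : (fun m => generator R β ω (fun v => (α' v).eval t) l m t) =
        fun m => generator R β ω α l m t := funext fun m =>
      generator_congr R β ω l m (fun v hv => by
        rw [hα', Function.update_of_ne hv.ne, eval_C]) t
    rw [hx] at h1
    exact h1
  simpa only [hev, ← map_pow] using key

/-- For a suitable seed, the generator preserves the span of the vectors of subproducts. -/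
theorem exists_seed_forall_mem_span {K : Type*} [Field K] [Infinite K] [Algebra F K] {e d R : ℕ}
    (he : ∀ i, Φ.expoSize i ≤ e) (hd : ∀ i j, (Φ.P i j).totalDegree ≤ d) (hR0 : 0 < R)
    (hd0 : 0 < d) (hR : Fintype.card Φ.SubExpo ≤ R) {β : ℕ → F} {ω : F}
    (hβ : Set.InjOn β (Set.Iio (R * R)))
    (hω : Set.InjOn (fun a : ℕ => ω ^ a) (Set.Iio (d * e * (R * R)))) (l N : ℕ) :
    ∃ α : ℕ → K, ∀ c < N, ∀ x : ℕ → K, subProd (Φ.blockSum l c x) ∈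
      Submodule.span K (Set.range fun t : K =>
        (subProd (Φ.blockSum l c fun i => generator R β ω α l i t) : Φ.SubExpo → K)) := by
  induction l generalizing N with
  | zero =>
    -- A block of level `0` is the single variable `c`, so the parameter `x c` reproduces its vector
    -- exactly.
    refine ⟨fun _ => 0, fun c _ x => Submodule.subset_span ⟨x c, ?_⟩⟩
    dsimp only
    congr 1
    refine Φ.blockSum_congr fun m hm => ?_
    rw [pow_zero, Nat.div_one] at hm
    rw [generator, hm]
  | succ l ih =>
    -- `N` blocks consist of `2 * N` half blocks. Each excludes finitely many `a`, so one element of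
    -- the infinite field `K` serves them all.
    obtain ⟨α, hα⟩ := ih (2 * N)
    have hfin := Set.Finite.biUnion (Set.finite_Iio (2 * N)) fun c _ =>
      Φ.finite_not_mem_span_generator (β := β) (K := K) he hd hR0 hd0 hR hω α l c
    obtain ⟨a, ha⟩ := hfin.exists_notMem
    simp only [Set.mem_iUnion, Set.mem_Iio, Set.mem_ofPred_eq, not_exists, not_not] at ha
    set α' := Function.update α l a with hα'
    have hspan : ∀ c < 2 * N, ∀ x : ℕ → K, subProd (Φ.blockSum l c x) ∈
        Submodule.span K {y | ∃ m < R, y = subProd (Φ.blockSum l c fun i =>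
          generator R β ω α l i (a * algebraMap F K (ω ^ m)))} := by
      intro c hc x
      refine Submodule.span_le.mpr ?_ (hα c hc x)
      rintro _ ⟨t, rfl⟩
      exact ha c hc t
    refine ⟨α', fun c hc x => ?_⟩
    rw [blockSum_succ, subProd_add]
    -- By bilinearity only pairs of condenser points remain, and the pair `(m', m)` lies on the new
    -- curve at the node `m * R + m'`.
    refine LinearMap.BilinMap.apply_apply_mem_of_mem_span _ _ _ (Φ.binomConv K) ?_ _ _
      (hspan (2 * c) (by omega) x) (hspan (2 * c + 1) (by omega) x)
    rintro _ ⟨m', hm', rfl⟩ _ ⟨m, hm, rfl⟩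
    rw [← subProd_add]
    have hq : m * R + m' < R * R := by nlinarith
    refine Submodule.subset_span ⟨algebraMap F K (β (m * R + m')), ?_⟩
    dsimp only
    rw [blockSum_succ]
    have hgen : ∀ i, generator R β ω α' (l + 1) i (algebraMap F K (β (m * R + m'))) =
        generator R β ω α l i
          (a * algebraMap F K (ω ^ digitSelect R l i (m * R + m'))) := by
      intro i
      rw [generator_succ_node hβ ω α' l i hq, hα', Function.update_self]
      exact generator_congr R β ω l i (fun v hv => Function.update_of_ne hv.ne _ _) _
    have h1 : Φ.blockSum l (2 * c)
        (fun i => generator R β ω α' (l + 1) i (algebraMap F K (β (m * R + m')))) =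
        Φ.blockSum l (2 * c) (fun i => generator R β ω α l i (a * algebraMap F K (ω ^ m'))) :=
      Φ.blockSum_congr fun i hi => by
        rw [hgen, digitSelect_of_even hm' (by omega)]
    have h2 : Φ.blockSum l (2 * c + 1)
        (fun i => generator R β ω α' (l + 1) i (algebraMap F K (β (m * R + m')))) =
        Φ.blockSum l (2 * c + 1) (fun i => generator R β ω α l i (a * algebraMap F K (ω ^ m))) :=
      Φ.blockSum_congr fun i hi => by
        rw [hgen, digitSelect_of_odd hm hm' (by omega)]
    rw [h1, h2]

/-- Over an infinite extension, some seed of the generator is not a zero of a nonzero circuit. -/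
theorem exists_seed_aeval_ne_zero {K : Type*} [Field K] [Infinite K] [Algebra F K] {e d R : ℕ}
    (he : ∀ i, Φ.expoSize i ≤ e) (hd : ∀ i j, (Φ.P i j).totalDegree ≤ d) (hR0 : 0 < R)
    (hd0 : 0 < d) (hR : Fintype.card Φ.SubExpo ≤ R) {β : ℕ → F} {ω : F}
    (hβ : Set.InjOn β (Set.Iio (R * R)))
    (hω : Set.InjOn (fun a : ℕ => ω ^ a) (Set.Iio (d * e * (R * R)))) {l : ℕ} (hl : n ≤ 2 ^ l)
    (hΦ : Φ.toPoly ≠ 0) :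
    ∃ α : ℕ → K,
      MvPolynomial.aeval (fun m : Fin n => generator R β ω α l m (α l)) Φ.toPoly ≠ 0 := by
  by_contra! hall
  obtain ⟨α, hα⟩ := Φ.exists_seed_forall_mem_span (K := K) he hd hR0 hd0 hR hβ hω l 1
  apply hΦ
  have hmap : MvPolynomial.map (algebraMap F K) Φ.toPoly = 0 := by
    refine MvPolynomial.funext fun y => ?_
    let x : ℕ → K := fun m => if h : m < n then y ⟨m, h⟩ else 0
    have hxy : y = fun m : Fin n => x m := by funext m; simp [x]
    rw [MvPolynomial.eval_map, ← MvPolynomial.aeval_def, hxy, Φ.aeval_toPoly hl, map_zero]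
    let φ : (Φ.SubExpo → K) →ₗ[K] K :=
      ∑ i, LinearMap.proj (⟨i, fun _ => Fin.last _⟩ : Φ.SubExpo)
    have hφ : ∀ v, φ v = ∑ i, v ⟨i, fun _ => Fin.last _⟩ := fun v => by simp [φ]
    rw [← hφ, ← LinearMap.mem_ker]
    refine (Submodule.span_le.mpr ?_) (hα 0 one_pos x)
    rintro _ ⟨t, rfl⟩
    rw [SetLike.mem_coe, LinearMap.mem_ker, hφ, ← Φ.aeval_toPoly hl]
    -- The curve parameter becomes the last seed coordinate, which the generator of level `l` does
    -- not read.
    rw [← hall (Function.update α l t), Function.update_self]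
    congr 2
    funext m
    exact generator_congr R β ω l m (fun v hv => (Function.update_of_ne hv.ne _ _).symm) t
  exact MvPolynomial.map_injective _ (algebraMap F K).injective (by rw [hmap, map_zero])

open Polynomial in
/-- A coordinate of a seed that is not a zero can be moved into any large enough set. -/
theorem exists_update_seed_aeval_ne_zero {K : Type*} [Field K] [Algebra F K] {e d R : ℕ}
    (he : ∀ i, Φ.expoSize i ≤ e) (hd : ∀ i j, (Φ.P i j).totalDegree ≤ d) (hR0 : 0 < R)
    (hd0 : 0 < d) {β : ℕ → F} {ω : F}
    (hβ : Set.InjOn β (Set.Iio (d * e * (R * R)))) {l : ℕ} (hl : n ≤ 2 ^ l) {α : ℕ → K}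
    (hα : MvPolynomial.aeval (fun m : Fin n => generator R β ω α l m (α l)) Φ.toPoly ≠ 0)
    (N : ℕ) :
    ∃ s < d * e * (R * R), MvPolynomial.aeval (fun m : Fin n => generator R β ω
      (Function.update α N (algebraMap F K (β s))) l m
      (Function.update α N (algebraMap F K (β s)) l)) Φ.toPoly ≠ 0 := by
  classical
  -- Coordinate `N` becomes an indeterminate. The resulting polynomial is nonzero because its value
  -- at the old coordinate is, and its degree is less than the number of available elements.
  let α' : ℕ → K[X] := Function.update (fun v => C (α v)) N X
  obtain ⟨p, hp⟩ : ∃ p : K[X],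
    p = MvPolynomial.aeval (fun m : Fin n => generator R β ω α' l m (α' l)) Φ.toPoly := ⟨_, rfl⟩
  have hpe : ∀ t, p.eval t = MvPolynomial.aeval (fun m : Fin n =>
      generator R β ω (Function.update α N t) l m (Function.update α N t l)) Φ.toPoly := by
    intro t
    have hα't : ∀ v, (α' v).eval t = Function.update α N t v := by
      intro v
      by_cases hv : v = N
      · subst hv; simp [α']
      · simp [α', Function.update_of_ne hv]
    have h1 := MvPolynomial.comp_aeval_apply
      (fun m : Fin n => generator R β ω α' l m (α' l))
      ((aeval (R := K) t).restrictScalars F) Φ.toPoly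
    simp only [map_generator, AlgHom.coe_restrictScalars', coe_aeval_eq_eval, hα't] at h1
    rw [hp, h1]
  have hp0 : p ≠ 0 := by
    intro h0
    apply hα
    have := hpe (α N)
    rwa [h0, eval_zero, Function.update_eq_self, eq_comm] at this
  have hpd : p.natDegree < d * e * (R * R) := by
    have hgen : ∀ m, (generator R β ω α' l m (α' l)).natDegree ≤ R * R := by
      intro m
      have := natDegree_generator_le hR0 β ω α' N (by simp [α'])
        (fun v hv => by simp [α', Function.update_of_ne hv]) l m 1
      rw [map_one, mul_one] at this
      exact this.trans (by split_ifs <;> omega)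
    have hsub := Φ.natDegree_subProd_blockSum_lt (N := R * R) he hd
      (Nat.mul_pos hd0 (Nat.mul_pos hR0 hR0)) l 0 hgen
    have hpsum := Φ.aeval_toPoly hl fun m => generator R β ω α' l m (α' l)
    rw [← hp] at hpsum
    have hT0 : 0 < d * e * (R * R) := by
      -- If the bound were `0`, no product gate could satisfy the strict inequality; the sum would
      -- be empty and `p = 0`.
      by_contra hT0
      have : IsEmpty (Fin k) := ⟨fun i => hT0 ((Nat.zero_le _).trans_lt
        (hsub ⟨i, fun _ => Fin.last _⟩))⟩
      exact hp0 (by rw [hpsum, Finset.univ_eq_empty, Finset.sum_empty])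
    refine Nat.lt_of_le_pred hT0 ?_
    rw [hpsum]
    exact natDegree_sum_le_of_forall_le _ _ fun i _ => Nat.le_pred_of_lt (hsub _)
  obtain ⟨s, hs, hps⟩ : ∃ s < d * e * (R * R), p.eval (algebraMap F K (β s)) ≠ 0 := by
    by_contra! hall
    refine hp0 (eq_zero_of_natDegree_lt_card_of_eval_eq_zero' p
      ((Finset.range (d * e * (R * R))).image fun s => algebraMap F K (β s)) ?_ ?_)
    · intro i hi
      obtain ⟨s, hs, rfl⟩ := Finset.mem_image.mp hi
      exact hall s (Finset.mem_range.mp hs)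
    · rw [Finset.card_image_of_injOn, Finset.card_range]
      · exact hpd
      · intro s hs s' hs' h
        exact hβ (by simpa using hs) (by simpa using hs') ((algebraMap F K).injective h)
  exact ⟨s, hs, by rwa [← hpe]⟩

/-- The generator, with seeds ranging over a grid, hits every nonzero diagonal circuit. -/
theorem exists_grid_seed_eval_ne_zero {e d R : ℕ}
    (he : ∀ i, Φ.expoSize i ≤ e) (hd : ∀ i j, (Φ.P i j).totalDegree ≤ d) (hR0 : 0 < R)
    (hd0 : 0 < d) (hR : Fintype.card Φ.SubExpo ≤ R) {β : ℕ → F} {ω : F}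
    (hβ : Set.InjOn β (Set.Iio (R * R)))
    (hβ' : Set.InjOn β (Set.Iio (d * e * (R * R))))
    (hω : Set.InjOn (fun a : ℕ => ω ^ a) (Set.Iio (d * e * (R * R)))) {l : ℕ} (hl : n ≤ 2 ^ l)
    (hΦ : Φ.toPoly ≠ 0) :
    ∃ a : ℕ → ℕ, (∀ v ≤ l, a v < d * e * (R * R)) ∧
      MvPolynomial.eval (fun m : Fin n => generator R β ω (fun v => β (a v)) l m (β (a l)))
        Φ.toPoly ≠ 0 := by
  -- `F` may be finite, whereas avoiding finitely many bad seeds needs an infinite field. The seed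
  -- is found in the closure and then moved into `F`.
  have hinf : Infinite (AlgebraicClosure F) := IsAlgClosed.instInfinite
  have hstep : ∀ N, ∃ α : ℕ → AlgebraicClosure F,
      (∀ v < N, ∃ s < d * e * (R * R), α v = algebraMap F _ (β s)) ∧
      MvPolynomial.aeval (fun m : Fin n => generator R β ω α l m (α l)) Φ.toPoly ≠ 0 := by
    intro N
    induction N with
    | zero =>
      obtain ⟨α, hα⟩ := Φ.exists_seed_aeval_ne_zero (K := AlgebraicClosure F) he hd hR0 hd0 hR hβ hω hl hΦ
      exact ⟨α, fun v hv => absurd hv (by omega), hα⟩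
    | succ N ih =>
      obtain ⟨α, hα, hne⟩ := ih
      obtain ⟨s, hs, hsne⟩ := Φ.exists_update_seed_aeval_ne_zero he hd hR0 hd0 hβ' hl hne N
      refine ⟨Function.update α N (algebraMap F _ (β s)), fun v hv => ?_, hsne⟩
      rcases Nat.lt_succ_iff_lt_or_eq.mp hv with h | h
      · rw [Function.update_of_ne h.ne]
        exact hα v h
      · subst h
        exact ⟨s, hs, Function.update_self ..⟩
  obtain ⟨α, hα, hne⟩ := hstep (l + 1)
  choose! a ha hαa using hα
  refine ⟨a, fun v hv => ha v (by omega), fun hzero => hne ?_⟩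
  have h1 := MvPolynomial.comp_aeval_apply
    (fun m : Fin n => generator R β ω (fun v => β (a v)) l m (β (a l)))
    (Algebra.ofId F (AlgebraicClosure F)) Φ.toPoly
  rw [MvPolynomial.aeval_eq_eval] at h1
  rw [show (MvPolynomial.eval _) Φ.toPoly = 0 from hzero, map_zero] at h1
  rw [h1]
  congr 2
  funext m
  rw [map_generator]
  simp only [Algebra.ofId_apply]
  rw [hαa l (by omega)]
  exact generator_congr R β ω l m (fun v hv => hαa v (by omega)) _

end DiagonalCircuit

/-! ### Cost bounds and a program logic -/

namespace FieldRAM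

/-- A bound for the length of the value of an expression, relative to the length of the cells. -/
def NExpr.weight : NExpr → ℕ
  | const c => 1 + c
  | load a => 1 + a.weight
  | op _ a b => a.weight + b.weight

/-- A bound for the cost of an expression, relative to the squared length of the cells. -/
def NExpr.effort : NExpr → ℕ
  | const c => 1 + c
  | load a => a.effort + (2 + a.weight)
  | op _ a b => a.effort + b.effort + (1 + a.weight) * (1 + b.weight)

/-- The counterpart of `NExpr.effort` for field expressions. -/
def FExpr.effort : FExpr → ℕ
  | zero => 1
  | one => 1
  | load a => a.effort + (1 + a.weight)
  | enum a => a.effort + 2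
  | add x y => x.effort + y.effort + 1
  | sub x y => x.effort + y.effort + 1
  | mul x y => x.effort + y.effort + 1
  | inv x => x.effort + 1

/-- The counterpart of `NExpr.effort` for tests. -/
def Test.effort : Test → ℕ
  | natEq a b => a.effort + b.effort + (1 + a.weight + b.weight)
  | natLt a b => a.effort + b.effort + (1 + a.weight + b.weight)
  | fldEq x y => x.effort + y.effort + 1

section

variable {F : Type*}

/-- All cells for natural numbers have length at most `b`. -/
def State.Bounded (b : ℕ) (s : State F) : Prop := ∀ a, (s.nat a).size ≤ b

/-- All elements of the enumeration that the expression reads have index at most `b`. -/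
def FExpr.EnumLE (b : ℕ) (s : State F) : FExpr → Prop
  | zero => True
  | one => True
  | load _ => True
  | enum a => a.eval s ≤ b
  | add x y => x.EnumLE b s ∧ y.EnumLE b s
  | sub x y => x.EnumLE b s ∧ y.EnumLE b s
  | mul x y => x.EnumLE b s ∧ y.EnumLE b s
  | inv x => x.EnumLE b s

/-- `FExpr.EnumLE` for tests. -/
def Test.EnumLE (b : ℕ) (s : State F) : Test → Prop
  | natEq _ _ => True
  | natLt _ _ => True
  | fldEq x y => x.EnumLE b s ∧ y.EnumLE b s

theorem NOp.size_eval_le (o : NOp) (x y : ℕ) : (o.eval x y).size ≤ x.size + y.size := by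
  cases o with
  | add =>
    rcases Nat.eq_zero_or_pos x with rfl | hx
    · simp [NOp.eval]
    rcases Nat.eq_zero_or_pos y with rfl | hy
    · simp [NOp.eval]
    rw [NOp.eval, Nat.size_le]
    have h1 := Nat.lt_size_self x
    have h2 := Nat.lt_size_self y
    rw [pow_add]
    nlinarith
  | sub => exact (Nat.size_le_size (Nat.sub_le x y)).trans (Nat.le_add_right _ _)
  | mul =>
    rw [NOp.eval, Nat.size_le, pow_add]
    exact Nat.mul_lt_mul'' (Nat.lt_size_self x) (Nat.lt_size_self y)
  | div => exact (Nat.size_le_size (Nat.div_le_self x y)).trans (Nat.le_add_right _ _)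
  | mod => exact (Nat.size_le_size (Nat.mod_le x y)).trans (Nat.le_add_right _ _)

theorem size_le_self (x : ℕ) : x.size ≤ x := Nat.size_le.mpr x.lt_two_pow_self

/-- Each operation at most adds lengths, so the length of a value is linear in the cell length with
a factor that depends on the syntax alone. -/
theorem NExpr.size_eval_le {b : ℕ} {s : State F} (hs : s.Bounded b) (x : NExpr) :
    (x.eval s).size ≤ x.weight * (b + 1) := by
  induction x with
  | const c =>
    simp only [NExpr.eval, NExpr.weight]
    nlinarith [size_le_self c]
  | load a _ =>
    simp only [NExpr.eval, NExpr.weight]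
    nlinarith [hs (a.eval s)]
  | op o x y hx hy =>
    simp only [NExpr.eval, NExpr.weight, add_mul]
    exact (o.size_eval_le _ _).trans (add_le_add hx hy)

theorem NExpr.cost_le {b : ℕ} {s : State F} (hs : s.Bounded b) (x : NExpr) :
    x.cost s ≤ x.effort * (b + 1) ^ 2 := by
  induction x with
  | const c =>
    simp only [NExpr.cost, NExpr.effort]
    have := size_le_self c
    nlinarith [Nat.one_le_pow 2 (b + 1) (by omega)]
  | load a ha =>
    simp only [NExpr.cost, NExpr.effort]
    have h1 := a.size_eval_le hs
    have h2 := hs (a.eval s)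
    nlinarith [Nat.zero_le b]
  | op o x y hx hy =>
    simp only [NExpr.cost, NExpr.effort]
    have h1 := x.size_eval_le hs
    have h2 := y.size_eval_le hs
    have h3 : 1 + (x.eval s).size ≤ (1 + x.weight) * (b + 1) := by nlinarith
    have h4 : 1 + (y.eval s).size ≤ (1 + y.weight) * (b + 1) := by nlinarith
    have h5 := Nat.mul_le_mul h3 h4
    nlinarith

theorem FExpr.cost_le {b : ℕ} {s : State F} (hs : s.Bounded b) (x : FExpr)
    (hx : x.EnumLE b s) : x.cost s ≤ x.effort * (b + 1) ^ 2 := by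
  have h1 : 1 ≤ (b + 1) ^ 2 := Nat.one_le_pow _ _ (by omega)
  induction x with
  | zero | one => simpa [FExpr.cost, FExpr.effort] using h1
  | load a =>
    simp only [FExpr.cost, FExpr.effort]
    have h2 := a.size_eval_le hs
    have h3 := a.cost_le hs
    nlinarith
  | enum a =>
    simp only [FExpr.cost, FExpr.effort]
    have h2 : a.eval s ≤ b := hx
    have h3 := a.cost_le hs
    nlinarith
  | add x y ihx ihy | sub x y ihx ihy | mul x y ihx ihy =>
    simp only [FExpr.cost, FExpr.effort]
    have := ihx hx.1
    have := ihy hx.2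
    nlinarith
  | inv x ih =>
    simp only [FExpr.cost, FExpr.effort]
    have := ih hx
    nlinarith

theorem Test.cost_le {b : ℕ} {s : State F} (hs : s.Bounded b) (x : Test)
    (hx : x.EnumLE b s) : x.cost s ≤ x.effort * (b + 1) ^ 2 := by
  cases x with
  | natEq x y | natLt x y =>
    simp only [Test.cost, Test.effort]
    have h1 := x.size_eval_le hs
    have h2 := y.size_eval_le hs
    have h3 := x.cost_le hs
    have h4 := y.cost_le hs
    nlinarith [Nat.zero_le b]
  | fldEq x y =>
    simp only [Test.cost, Test.effort]
    have h3 := x.cost_le hs hx.1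
    have h4 := y.cost_le hs hx.2
    nlinarith [Nat.one_le_pow 2 (b + 1) (by omega)]

/-- A common bound for the cost of the single steps of the programs below. -/
def stepCost (b : ℕ) : ℕ := 100000 * (b + 1) ^ 2

/-- The constant only has to exceed the efforts of the finitely many expressions in the fixed
programs; each use is settled by `decide`. -/
theorem Test.cost_add_one_le {b : ℕ} {s : State F} (hs : s.Bounded b) {x : Test} (hx : x.EnumLE b s)
    (hc : x.effort + 1 ≤ 100000) : x.cost s + 1 ≤ stepCost b := by
  have h1 := x.cost_le hs hx
  have h2 := Nat.mul_le_mul_right ((b + 1) ^ 2) hc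
  have h3 : 1 ≤ (b + 1) ^ 2 := Nat.one_le_pow _ _ (by omega)
  rw [stepCost]
  nlinarith

/-- The state with `y` written to the cell `x` for natural numbers. -/
def State.setN (s : State F) (x y : ℕ) : State F := { s with nat := Function.update s.nat x y }

/-- The state with `y` written to the cell `x` for field elements. -/
def State.setF (s : State F) (x : ℕ) (y : F) : State F :=
  { s with fld := Function.update s.fld x y }

@[simp] theorem State.setN_nat (s : State F) (x y a : ℕ) :
    (s.setN x y).nat a = if a = x then y else s.nat a := Function.update_apply ..

@[simp] theorem State.setN_fld (s : State F) (x y : ℕ) : (s.setN x y).fld = s.fld := rfl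

@[simp] theorem State.setF_fld (s : State F) (x : ℕ) (y : F) (a : ℕ) :
    (s.setF x y).fld a = if a = x then y else s.fld a := Function.update_apply ..

@[simp] theorem State.setF_nat (s : State F) (x : ℕ) (y : F) : (s.setF x y).nat = s.nat := rfl

variable [Field F] {enu : ℕ → F} {b : ℕ}

/-- Started in the state `s` with cells of length at most `b`, the program halts within `m` steps
of cost `stepCost b` in a state with cells of length at most `b` that satisfies `Q`. -/
def Reaches (enu : ℕ → F) (b : ℕ) (p : Prog) (s : State F) (m : ℕ) (Q : State F → Prop) : Prop :=
  s.Bounded b → ∃ t s', Exec enu p s t s' ∧ t ≤ m * stepCost b ∧ s'.Bounded b ∧ Q s'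

theorem Reaches.mono {p : Prog} {s : State F} {m m' : ℕ} {Q Q' : State F → Prop}
    (h : Reaches enu b p s m Q) (hm : m ≤ m') (hQ : ∀ s', Q s' → Q' s') :
    Reaches enu b p s m' Q' := by
  intro hs
  obtain ⟨t, s', he, ht, hb, hq⟩ := h hs
  exact ⟨t, s', he, ht.trans (Nat.mul_le_mul_right _ hm), hb, hQ _ hq⟩

theorem Reaches.skip {s : State F} {Q : State F → Prop} (h : Q s) :
    Reaches enu b .skip s 1 Q := fun hs =>
  ⟨1, s, .skip s, by
    have : 1 ≤ (b + 1) ^ 2 := Nat.one_le_pow _ _ (by omega)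
    rw [stepCost]; omega, hs, h⟩

/-- The postcondition of `p` is the claim about `q`, so a proof can follow a program forward, one
instruction at a time. -/
theorem Reaches.seq {p q : Prog} {s : State F} {m₁ m₂ : ℕ} {Q : State F → Prop}
    (h : Reaches enu b p s m₁ fun s' => Reaches enu b q s' m₂ Q) :
    Reaches enu b (.seq p q) s (m₁ + m₂) Q := by
  intro hs
  obtain ⟨t₁, s₁, he₁, ht₁, hb₁, h₁⟩ := h hs
  obtain ⟨t₂, s₂, he₂, ht₂, hb₂, h₂⟩ := h₁ hb₁
  exact ⟨t₁ + t₂, s₂, .seq he₁ he₂, by rw [add_mul]; omega, hb₂, h₂⟩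

theorem Reaches.setNat {a v : NExpr} {s : State F} {Q : State F → Prop} (x y : ℕ)
    (hx : a.eval s = x) (hy : v.eval s = y) (hyb : y.size ≤ b)
    (hc : a.effort + v.effort + (1 + a.weight + v.weight) ≤ 100000)
    (h : Q (s.setN x y)) : Reaches enu b (.setNat a v) s 1 Q := by
  intro hs
  refine ⟨_, _, .setNat a v s, ?_, ?_, ?_⟩
  · have h1 := a.cost_le hs
    have h2 := v.cost_le hs
    have h3 := a.size_eval_le hs
    have h4 := v.size_eval_le hs
    have h5 := Nat.mul_le_mul_right ((b + 1) ^ 2) hc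
    rw [stepCost, one_mul]
    nlinarith [Nat.zero_le b]
  · rw [hx, hy]
    intro c
    change ((s.setN x y).nat c).size ≤ b
    rw [State.setN_nat]
    split_ifs
    · exact hyb
    · exact hs c
  · rw [hx, hy]
    exact h

theorem Reaches.setFld {a : NExpr} {v : FExpr} {s : State F} {Q : State F → Prop} (x : ℕ) (y : F)
    (hx : a.eval s = x) (hy : v.eval enu s = y) (hv : v.EnumLE b s)
    (hc : a.effort + v.effort + (1 + a.weight) ≤ 100000)
    (h : Q (s.setF x y)) : Reaches enu b (.setFld a v) s 1 Q := by
  intro hs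
  refine ⟨_, _, .setFld a v s, ?_, hs, ?_⟩
  · have h1 := a.cost_le hs
    have h2 := v.cost_le hs hv
    have h3 := a.size_eval_le hs
    have h5 := Nat.mul_le_mul_right ((b + 1) ^ 2) hc
    rw [stepCost, one_mul]
    nlinarith [Nat.zero_le b]
  · rw [hx, hy]
    exact h

theorem Reaches.cond {x : Test} {p q : Prog} {s : State F} {m : ℕ} {Q : State F → Prop}
    (hx : x.EnumLE b s) (hc : x.effort + 1 ≤ 100000)
    (hp : x.holds enu s → Reaches enu b p s m Q) (hq : ¬ x.holds enu s → Reaches enu b q s m Q) :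
    Reaches enu b (.cond x p q) s (m + 1) Q := by
  intro hs
  have hcost := Test.cost_add_one_le hs hx hc
  by_cases h : x.holds enu s
  · obtain ⟨t, s', he, ht, hb, hQ⟩ := hp h hs
    exact ⟨_, s', .condTrue h he, by rw [add_mul]; omega, hb, hQ⟩
  · obtain ⟨t, s', he, ht, hb, hQ⟩ := hq h hs
    exact ⟨_, s', .condFalse h he, by rw [add_mul]; omega, hb, hQ⟩

/-- The invariant carries the iteration count and decides the test, so there are exactly `N` rounds
and one final failing test. -/
theorem Reaches.loop {x : Test} {p : Prog} {s : State F} {m N : ℕ} {Q : State F → Prop}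
    (I : ℕ → State F → Prop) (hx : ∀ s : State F, x.EnumLE b s) (hc : x.effort + 1 ≤ 100000)
    (h0 : I 0 s)
    (hstep : ∀ j < N, ∀ s, I j s → x.holds enu s ∧ Reaches enu b p s m (I (j + 1)))
    (hend : ∀ s, I N s → ¬ x.holds enu s ∧ Q s) :
    Reaches enu b (.loop x p) s (N * (m + 1) + 1) Q := by
  have key : ∀ r j s, j + r = N → I j s → Reaches enu b (.loop x p) s (r * (m + 1) + 1) Q := by
    intro r
    induction r with
    | zero =>
      intro j s hj hI hs
      obtain rfl : j = N := hj
      have hcost := Test.cost_add_one_le hs (hx s) hc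
      exact ⟨_, s, .loopFalse (hend s hI).1, by omega, hs, (hend s hI).2⟩
    | succ r ih =>
      intro j s hj hI hs
      have hcost := Test.cost_add_one_le hs (hx s) hc
      obtain ⟨hh, hp⟩ := hstep j (by omega) s hI
      obtain ⟨t₁, s₁, he₁, ht₁, hb₁, hI₁⟩ := hp hs
      obtain ⟨t₂, s₂, he₂, ht₂, hb₂, hQ⟩ := ih (j + 1) s₁ (by omega) hI₁ hb₁
      refine ⟨_, s₂, .loopTrue hh he₁ he₂, ?_, hb₂, hQ⟩
      calc x.cost s + 1 + t₁ + t₂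
          ≤ stepCost b + m * stepCost b + (r * (m + 1) + 1) * stepCost b := by omega
        _ = ((r + 1) * (m + 1) + 1) * stepCost b := by ring
  exact key N 0 s (by omega) h0

end

end FieldRAM

/-! ### The program -/

namespace FieldRAM

/-- The content of the cell `c`. -/
abbrev cell (c : ℕ) : NExpr := .load (.const c)

/-- The address of the `c`-th field cell after the output cells. -/
abbrev scratch (c : ℕ) : NExpr := .op .add (cell 0) (.const c)

/-- The content of the `c`-th field cell after the output cells. -/
abbrev fcell (c : ℕ) : FExpr := .load (scratch c)

/-- `cell c := v`. -/
abbrev assign (c : ℕ) (v : NExpr) : Prog := .setNat (.const c) v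

/-- `cell c := cell c + 1`. -/
abbrev incr (c : ℕ) : Prog := assign c (.op .add (cell c) (.const 1))

/-- One Lagrange basis polynomial: the nodes have indices below cell 6, the basis polynomial has
the index in cell 13, and the argument is in `fcell 3`. The result is in `fcell 2`. -/
def lagrangeProg : Prog :=
  -- Layout for all programs. Number cells: 0–4 input, 5–7 `R`, `R * R`, `T`, 8 coordinate or search
  -- index, 9 remaining digits of `i` or an exponent, 10 `2 ^ j`, 11 row address, 12 column, 13
  -- node, 14 Lagrange factor. Field cells: output below `n`, then `ω`, a sum, a product, the
  -- current argument, and from `n + 4` on the table.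
  .seq (.setFld (scratch 2) .one) <| .seq (assign 14 (.const 0)) <|
  .loop (.natLt (cell 14) (cell 6)) <| .seq
    (.cond (.natEq (cell 14) (cell 13)) .skip
      (.setFld (scratch 2) (.mul (fcell 2) (.mul (.sub (fcell 3) (.enum (cell 14)))
        (.inv (.sub (.enum (cell 13)) (.enum (cell 14))))))))
    (incr 14)

/-- The address of the entry of the previous row that is selected by the index in cell 13. -/
def selectExpr : NExpr :=
  .op .add (.op .sub (cell 11) (cell 5)) (.op .mod (.op .div (cell 13) (.op .add (.const 1)
    (.op .mul (.op .sub (cell 5) (.const 1))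
      (.op .mod (.op .div (cell 8) (cell 10)) (.const 2))))) (cell 5))

/-- One entry of a row of the table of generator values. The result is in `fcell 1`. -/
def entryProg : Prog :=
  .seq (.setFld (scratch 1) .zero) <| .seq (assign 13 (.const 0)) <|
  .loop (.natLt (cell 13) (cell 6)) <| .seq lagrangeProg <| .seq
    (.setFld (scratch 1) (.add (fcell 1) (.mul (fcell 2) (.load selectExpr))))
    (incr 13)

/-- One row of the table, at the address in cell 11. -/
def rowProg : Prog :=
  .seq (assign 12 (.const 0)) <|
  .loop (.natLt (cell 12) (cell 5)) <| .seq entryProg <| .seq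
    (.setFld (.op .add (cell 11) (cell 12)) (fcell 1)) <| .seq
    (.setFld (scratch 3) (.mul (fcell 3) (fcell 0))) (incr 12)

/-- The first row of the table. -/
def firstRowProg : Prog :=
  .seq (assign 12 (.const 0)) <|
  .loop (.natLt (cell 12) (cell 5)) <| .seq
    (.setFld (.op .add (cell 11) (cell 12)) (fcell 3)) <| .seq
    (.setFld (scratch 3) (.mul (fcell 3) (fcell 0))) (incr 12)

/-- All further rows of the table. -/
def layersProg : Prog :=
  -- `2 ^ j < n` holds exactly for `j < ⌈lg n⌉`, so no logarithm is computed.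
  .loop (.natLt (cell 10) (cell 0)) <|
  .seq (assign 9 (.op .div (cell 9) (cell 7))) <| .seq (assign 11 (.op .add (cell 11) (cell 5))) <|
  .seq (.setFld (scratch 3) (.enum (.op .mod (cell 9) (cell 7)))) <| .seq rowProg <|
  assign 10 (.op .mul (cell 10) (.const 2))

/-- All coordinates of the output. -/
def coordsProg : Prog :=
  .seq (assign 8 (.const 0)) <| .loop (.natLt (cell 8) (cell 0)) <|
  .seq (assign 9 (cell 4)) <| .seq (assign 10 (.const 1)) <|
  .seq (assign 11 (.op .add (cell 0) (.const 4))) <|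
  .seq (.setFld (scratch 3) (.enum (.op .mod (cell 9) (cell 7)))) <|
  .seq firstRowProg <| .seq layersProg <| .seq (.setFld (cell 8) (.load (cell 11))) (incr 8)

/-- The product over `0 < a < T` of `w ^ a - 1`, times `w`, where `w` is in `fcell 0`. -/
def orderProg : Prog :=
  .seq (.setFld (scratch 1) (fcell 0)) <| .seq (.setFld (scratch 2) (fcell 0)) <|
  .seq (assign 9 (.const 1)) <| .loop (.natLt (cell 9) (cell 7)) <|
  .seq (.setFld (scratch 1) (.mul (fcell 1) (.sub (fcell 2) .one))) <|
  .seq (.setFld (scratch 2) (.mul (fcell 2) (fcell 0))) (incr 9)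

/-- The search for an element of large multiplicative order. -/
def searchProg : Prog :=
  -- Memory starts at `0`, so the loop is entered without initialization.
  .loop (.fldEq (fcell 1) .zero) <|
  .seq (.setFld (scratch 0) (.enum (cell 8))) <| .seq orderProg (incr 8)

/-- The program for the points of the hitting set. -/
def hittingProg : Prog :=
  .seq (assign 5 (.op .mul (cell 1) (cell 2))) <| .seq (assign 6 (.op .mul (cell 5) (cell 5))) <|
  .seq (assign 7 (.op .mul (.op .mul (cell 3) (cell 2)) (cell 6))) <| .seq searchProg coordsProg

/-! ### Correctness and running time of the program -/

section

variable {F : Type*} [Field F] {enu : ℕ → F} {b : ℕ}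

theorem reaches_lagrangeProg {s : State F} {n Q q : ℕ} (hn : s.nat 0 = n) (hQ : s.nat 6 = Q)
    (hq : s.nat 13 = q) (hqQ : q < Q) (hQb : Q ≤ b) :
    Reaches enu b lagrangeProg s (1 + (1 + (Q * (1 + 1 + 1 + 1) + 1))) fun s' =>
      (∀ a < 14, s'.nat a = s.nat a) ∧ (∀ a, a ≠ n + 2 → s'.fld a = s.fld a) ∧
      s'.fld (n + 2) = lagrangeBasis Q enu q (s.fld (n + 3)) := by
  refine .seq (.setFld (n + 2) 1 (by simp [NExpr.eval, NOp.eval, hn]) rfl trivial (by decide) ?_)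
  refine .seq (.setNat 14 0 rfl rfl (by simp) (by decide) ?_)
  refine .loop (fun u s' => (∀ a < 14, s'.nat a = s.nat a) ∧ s'.nat 14 = u ∧
    (∀ a, a ≠ n + 2 → s'.fld a = s.fld a) ∧
    s'.fld (n + 2) = lagrangeBasis u enu q (s.fld (n + 3))) (fun _ => trivial) (by decide) ?_ ?_ ?_
  · refine ⟨fun a ha => ?_, ?_, fun a ha => ?_, ?_⟩
    · simp [ha.ne]
    · simp
    · simp [ha]
    · simp [lagrangeBasis]
  · rintro u hu s₁ ⟨h1, h2, h3, h4⟩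
    have e0 : s₁.nat 0 = n := by rw [h1 0 (by omega), hn]
    have e6 : s₁.nat 6 = Q := by rw [h1 6 (by omega), hQ]
    have e13 : s₁.nat 13 = q := by rw [h1 13 (by omega), hq]
    refine ⟨by simpa [Test.holds, NExpr.eval, h2, e6] using hu, .seq (m₁ := 1 + 1) (m₂ := 1) ?_⟩
    have hinc : (u + 1).size ≤ b := (size_le_self _).trans (by omega)
    refine .cond (m := 1) trivial (by decide) (fun h => ?_) (fun h => ?_)
    · refine Reaches.skip ?_
      have huq : u = q := by simpa [Test.holds, NExpr.eval, h2, e13] using h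
      refine .setNat 14 (u + 1) rfl (by simp [NExpr.eval, NOp.eval, h2]) hinc (by decide) ?_
      refine ⟨fun a ha => ?_, ?_, fun a ha => ?_, ?_⟩
      · simp [ha.ne, h1 a ha]
      · simp
      · simp [h3 a ha]
      · simp [h4, lagrangeBasis, Finset.prod_range_succ, huq]
    · have huq : u ≠ q := by simpa [Test.holds, NExpr.eval, h2, e13] using h
      refine .setFld (n + 2) (lagrangeBasis (u + 1) enu q (s.fld (n + 3)))
        (by simp [NExpr.eval, NOp.eval, e0]) ?_ ?_ (by decide) ?_
      · simp [FExpr.eval, NExpr.eval, NOp.eval, e0, h2, e13, h4, h3 (n + 3) (by omega),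
          lagrangeBasis, Finset.prod_range_succ, huq]
      · simp only [FExpr.EnumLE, NExpr.eval, h2, e13, true_and]
        omega
      refine .setNat 14 (u + 1) rfl (by simp [NExpr.eval, NOp.eval, h2]) hinc (by decide) ?_
      refine ⟨fun a ha => ?_, ?_, fun a ha => ?_, ?_⟩
      · simp [ha.ne, h1 a ha]
      · simp
      · simp [ha, h3 a ha]
      · simp
  · rintro s₁ ⟨h1, h2, h3, h4⟩
    refine ⟨by simp [Test.holds, NExpr.eval, h2, h1 6, hQ], h1, h3, h4⟩

/-- The cost of `entryProg`. -/
def entryCost {A : Type*} [CommSemiring A] (Q : A) : A :=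
  1 + (1 + (Q * ((1 + (1 + (Q * (1 + 1 + 1 + 1) + 1))) + (1 + 1) + 1) + 1))

theorem reaches_entryProg {s : State F} {n R iv j row : ℕ} (hn : s.nat 0 = n) (hR : s.nat 5 = R)
    (hQ : s.nat 6 = R * R) (hiv : s.nat 8 = iv) (hj : s.nat 10 = 2 ^ j) (hrow : s.nat 11 = row)
    (hRn : n + 4 + R ≤ row) (hQb : R * R ≤ b) :
    Reaches enu b entryProg s (entryCost (R * R)) fun s' =>
      (∀ a < 13, s'.nat a = s.nat a) ∧ (∀ a, a ≠ n + 1 → a ≠ n + 2 → s'.fld a = s.fld a) ∧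
      s'.fld (n + 1) = ∑ q ∈ Finset.range (R * R), lagrangeBasis (R * R) enu q (s.fld (n + 3)) *
        s.fld (row - R + digitSelect R j iv q) := by
  refine .seq (.setFld (n + 1) 0 (by simp [NExpr.eval, NOp.eval, hn]) rfl trivial (by decide) ?_)
  refine .seq (.setNat 13 0 rfl rfl (by simp) (by decide) ?_)
  refine .loop (fun u s' => (∀ a < 13, s'.nat a = s.nat a) ∧ s'.nat 13 = u ∧
    (∀ a, a ≠ n + 1 → a ≠ n + 2 → s'.fld a = s.fld a) ∧
    s'.fld (n + 1) = ∑ q ∈ Finset.range u, lagrangeBasis (R * R) enu q (s.fld (n + 3)) *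
        s.fld (row - R + digitSelect R j iv q)) (fun _ => trivial) (by decide) ?_ ?_ ?_
  · refine ⟨fun a ha => ?_, ?_, fun a ha _ => ?_, ?_⟩
    · simp [ha.ne]
    · simp
    · simp [ha]
    · simp
  · rintro u hu s₁ ⟨h1, h2, h3, h4⟩
    have e0 : s₁.nat 0 = n := by rw [h1 0 (by omega), hn]
    have e6 : s₁.nat 6 = R * R := by rw [h1 6 (by omega), hQ]
    refine ⟨by simpa [Test.holds, NExpr.eval, h2, e6] using hu, .seq ?_⟩
    refine (reaches_lagrangeProg e0 e6 h2 hu hQb).mono le_rfl ?_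
    rintro s₂ ⟨g1, g2, g3⟩
    have f0 : s₂.nat 0 = n := by rw [g1 0 (by omega), e0]
    have f5 : s₂.nat 5 = R := by rw [g1 5 (by omega), h1 5 (by omega), hR]
    have f8 : s₂.nat 8 = iv := by rw [g1 8 (by omega), h1 8 (by omega), hiv]
    have f10 : s₂.nat 10 = 2 ^ j := by rw [g1 10 (by omega), h1 10 (by omega), hj]
    have f11 : s₂.nat 11 = row := by rw [g1 11 (by omega), h1 11 (by omega), hrow]
    have f13 : s₂.nat 13 = u := by rw [g1 13 (by omega), h2]
    have hsel : selectExpr.eval s₂ = row - R + digitSelect R j iv u := by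
      simp [selectExpr, NExpr.eval, NOp.eval, f5, f8, f10, f11, f13, digitSelect]
    refine .seq (.setFld (n + 1) _ (by simp [NExpr.eval, NOp.eval, f0]) rfl ?_ (by decide) ?_)
    · simp [FExpr.EnumLE]
    refine .setNat 13 (u + 1) rfl (by simp [NExpr.eval, NOp.eval, f13])
      ((size_le_self _).trans (by omega)) (by decide) ?_
    refine ⟨fun a ha => ?_, ?_, fun a ha ha' => ?_, ?_⟩
    · simp [ha.ne, g1 a (by omega), h1 a ha]
    · simp
    · simp [ha, g2 a ha', h3 a ha ha']
    -- The previous row lies beyond the scratch cells, so it survives the computation of the entry.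
    · have hne : ∀ c, row - R + c ≠ n + 1 ∧ row - R + c ≠ n + 2 := fun c => by omega
      simp [FExpr.eval, hsel, NExpr.eval, NOp.eval, f0, g3, g2 (n + 1), h4, h3 (n + 3),
        Finset.sum_range_succ, g2 _ (hne _).2, h3 _ (hne _).1 (hne _).2]
  · rintro s₁ ⟨h1, h2, h3, h4⟩
    refine ⟨by simp [Test.holds, NExpr.eval, h2, h1 6, hQ], h1, h3, h4⟩

/-- The cost of `rowProg`. -/
def rowCost {A : Type*} [CommSemiring A] (R : A) : A :=
  1 + (R * (entryCost (R * R) + (1 + (1 + 1)) + 1) + 1)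

theorem reaches_rowProg {s : State F} {n R iv j row : ℕ} (hn : s.nat 0 = n) (hR : s.nat 5 = R)
    (hQ : s.nat 6 = R * R) (hiv : s.nat 8 = iv) (hj : s.nat 10 = 2 ^ j) (hrow : s.nat 11 = row)
    (hRn : n + 4 + R ≤ row) (hR0 : 0 < R) (hQb : R * R ≤ b) :
    Reaches enu b rowProg s (rowCost R) fun s' =>
      (∀ a < 12, s'.nat a = s.nat a) ∧ (∀ a ≤ n, s'.fld a = s.fld a) ∧
      ∀ m < R, s'.fld (row + m) = ∑ q ∈ Finset.range (R * R),
        lagrangeBasis (R * R) enu q (s.fld (n + 3) * s.fld n ^ m) *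
          s.fld (row - R + digitSelect R j iv q) := by
  refine .seq (.setNat 12 0 rfl rfl (by simp) (by decide) ?_)
  refine .loop (fun u s' => (∀ a < 12, s'.nat a = s.nat a) ∧ s'.nat 12 = u ∧
    (∀ a ≤ n, s'.fld a = s.fld a) ∧ (∀ a, n + 4 ≤ a → a < row → s'.fld a = s.fld a) ∧
    s'.fld (n + 3) = s.fld (n + 3) * s.fld n ^ u ∧
    ∀ m < u, s'.fld (row + m) = ∑ q ∈ Finset.range (R * R),
        lagrangeBasis (R * R) enu q (s.fld (n + 3) * s.fld n ^ m) *
          s.fld (row - R + digitSelect R j iv q)) (fun _ => trivial) (by decide) ?_ ?_ ?_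
  · refine ⟨fun a ha => ?_, ?_, fun a ha => ?_, fun a _ _ => ?_, ?_, fun m hm => ?_⟩
    · simp [ha.ne]
    · simp
    · simp
    · simp
    · simp
    · omega
  · rintro u hu s₁ ⟨h1, h2, h3, h4, h5, h6⟩
    have e0 : s₁.nat 0 = n := by rw [h1 0 (by omega), hn]
    have e5 : s₁.nat 5 = R := by rw [h1 5 (by omega), hR]
    have e6 : s₁.nat 6 = R * R := by rw [h1 6 (by omega), hQ]
    have e8 : s₁.nat 8 = iv := by rw [h1 8 (by omega), hiv]
    have e10 : s₁.nat 10 = 2 ^ j := by rw [h1 10 (by omega), hj]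
    have e11 : s₁.nat 11 = row := by rw [h1 11 (by omega), hrow]
    refine ⟨by simpa [Test.holds, NExpr.eval, h2, e5] using hu, .seq ?_⟩
    refine (reaches_entryProg e0 e5 e6 e8 e10 e11 hRn hQb).mono le_rfl ?_
    rintro s₂ ⟨g1, g2, g3⟩
    have f0 : s₂.nat 0 = n := by rw [g1 0 (by omega), e0]
    have f11 : s₂.nat 11 = row := by rw [g1 11 (by omega), e11]
    have f12 : s₂.nat 12 = u := by rw [g1 12 (by omega), h2]
    refine .seq (.setFld (row + u) (s₂.fld (n + 1)) (by simp [NExpr.eval, NOp.eval, f11, f12])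
      (by simp [FExpr.eval, NExpr.eval, NOp.eval, f0]) trivial (by decide) ?_)
    refine .seq (.setFld (n + 3) (s.fld (n + 3) * s.fld n ^ (u + 1))
      (by simp [NExpr.eval, NOp.eval, f0]) ?_ ⟨trivial, trivial⟩ (by decide) ?_)
    · have hne3 : n + 3 ≠ row + u := by omega
      have hne0 : n ≠ row + u := by omega
      simp [FExpr.eval, NExpr.eval, NOp.eval, f0, hne3, hne0, g2 (n + 3), g2 n, h5, h3 n,
        pow_succ, mul_assoc]
    refine .setNat 12 (u + 1) rfl (by simp [NExpr.eval, NOp.eval, f12])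
      ((size_le_self _).trans (by nlinarith)) (by decide) ?_
    refine ⟨fun a ha => ?_, ?_, fun a ha => ?_, fun a ha ha' => ?_, ?_, fun m hm => ?_⟩
    · simp [ha.ne, g1 a (by omega), h1 a ha]
    · simp
    · have i1 : a ≠ n + 3 := by omega
      have i2 : a ≠ row + u := by omega
      simp [i1, i2, g2 a (by omega) (by omega), h3 a ha]
    · have i1 : a ≠ n + 3 := by omega
      have i2 : a ≠ row + u := by omega
      simp [i1, i2, g2 a (by omega) (by omega), h4 a ha ha']
    · simp
    · have i1 : row + m ≠ n + 3 := by omega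
      rcases Nat.lt_succ_iff_lt_or_eq.mp hm with hm | rfl
      · have i2 : row + m ≠ row + u := by omega
        simp only [State.setN_fld, State.setF_fld, if_neg i1, if_neg i2]
        rw [g2 _ (by omega) (by omega), h6 m hm]
      · simp only [State.setN_fld, State.setF_fld, if_neg i1, if_true]
        rw [g3, h5]
        refine Finset.sum_congr rfl fun q _ => ?_
        have : digitSelect R j iv q < R := Nat.mod_lt _ hR0
        rw [h4 _ (by omega) (by omega)]
  · rintro s₁ ⟨h1, h2, h3, h4, h5, h6⟩
    refine ⟨by simp [Test.holds, NExpr.eval, h2, h1 5, hR], h1, h3, h6⟩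

/-- The cost of `firstRowProg`. -/
def firstRowCost {A : Type*} [CommSemiring A] (R : A) : A := 1 + (R * (1 + (1 + 1) + 1) + 1)

theorem reaches_firstRowProg {s : State F} {n R row : ℕ} (hn : s.nat 0 = n) (hR : s.nat 5 = R)
    (hrow : s.nat 11 = row) (hRn : n + 4 ≤ row) (hQb : R ≤ b) :
    Reaches enu b firstRowProg s (firstRowCost R) fun s' =>
      (∀ a < 12, s'.nat a = s.nat a) ∧ (∀ a ≤ n, s'.fld a = s.fld a) ∧
      ∀ m < R, s'.fld (row + m) = s.fld (n + 3) * s.fld n ^ m := by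
  refine .seq (.setNat 12 0 rfl rfl (by simp) (by decide) ?_)
  refine .loop (fun u s' => (∀ a < 12, s'.nat a = s.nat a) ∧ s'.nat 12 = u ∧
    (∀ a ≤ n, s'.fld a = s.fld a) ∧
    s'.fld (n + 3) = s.fld (n + 3) * s.fld n ^ u ∧
    ∀ m < u, s'.fld (row + m) = s.fld (n + 3) * s.fld n ^ m)
    (fun _ => trivial) (by decide) ?_ ?_ ?_
  · refine ⟨fun a ha => ?_, ?_, fun a ha => ?_, ?_, fun m hm => ?_⟩
    · simp [ha.ne]
    · simp
    · simp
    · simp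
    · omega
  · rintro u hu s₂ ⟨h1, h2, h3, h5, h6⟩
    have f0 : s₂.nat 0 = n := by rw [h1 0 (by omega), hn]
    have f5 : s₂.nat 5 = R := by rw [h1 5 (by omega), hR]
    have f11 : s₂.nat 11 = row := by rw [h1 11 (by omega), hrow]
    refine ⟨by simpa [Test.holds, NExpr.eval, h2, f5] using hu, ?_⟩
    refine .seq (.setFld (row + u) (s₂.fld (n + 3)) (by simp [NExpr.eval, NOp.eval, f11, h2])
      (by simp [FExpr.eval, NExpr.eval, NOp.eval, f0]) trivial (by decide) ?_)
    refine .seq (.setFld (n + 3) (s.fld (n + 3) * s.fld n ^ (u + 1))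
      (by simp [NExpr.eval, NOp.eval, f0]) ?_ ⟨trivial, trivial⟩ (by decide) ?_)
    · have hne3 : n + 3 ≠ row + u := by omega
      have hne0 : n ≠ row + u := by omega
      simp [FExpr.eval, NExpr.eval, NOp.eval, f0, hne3, hne0, h5, h3 n, pow_succ, mul_assoc]
    refine .setNat 12 (u + 1) rfl (by simp [NExpr.eval, NOp.eval, h2])
      ((size_le_self _).trans (by omega)) (by decide) ?_
    refine ⟨fun a ha => ?_, ?_, fun a ha => ?_, ?_, fun m hm => ?_⟩
    · simp [ha.ne, h1 a ha]
    · simp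
    · have i1 : a ≠ n + 3 := by omega
      have i2 : a ≠ row + u := by omega
      simp [i1, i2, h3 a ha]
    · simp
    · have i1 : row + m ≠ n + 3 := by omega
      rcases Nat.lt_succ_iff_lt_or_eq.mp hm with hm | rfl
      · have i2 : row + m ≠ row + u := by omega
        simp only [State.setN_fld, State.setF_fld, if_neg i1, if_neg i2]
        rw [h6 m hm]
      · simp only [State.setN_fld, State.setF_fld, if_neg i1, if_true]
        rw [h5]
  · rintro s₁ ⟨h1, h2, h3, h5, h6⟩
    refine ⟨by simp [Test.holds, NExpr.eval, h2, h1 5, hR], h1, h3, h6⟩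

end

end FieldRAM

namespace FieldRAM

section

variable {F : Type*} [Field F] {enu : ℕ → F} {b : ℕ}

/-- The cost of `layersProg` with `l` layers. -/
def layersCost {A : Type*} [CommSemiring A] (R l : A) : A :=
  l * (1 + (1 + (1 + (rowCost R + 1))) + 1) + 1

/-- Row `j` stores the level `j` values at the `R` parameters `α_j * ω ^ m`, and row `j + 1` needs
no others. The table thus replaces a recursion with `R * R` branches per level by a polynomial
number of steps. -/
theorem reaches_layersProg {s : State F} {n R T iv i : ℕ} (hn : s.nat 0 = n) (hR : s.nat 5 = R)
    (hQ : s.nat 6 = R * R) (hT : s.nat 7 = T) (hiv : s.nat 8 = iv) (hi : s.nat 9 = i)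
    (hp : s.nat 10 = 1) (hrow : s.nat 11 = n + 4) (hR0 : 0 < R) (hT0 : 0 < T) (hQb : R * R ≤ b)
    (hTb : T ≤ b) (hib : i.size ≤ b) (hnb : n + 4 + Nat.clog 2 n * R ≤ b)
    (hs : ∀ m < R, s.fld (n + 4 + m) = enu (i % T) * s.fld n ^ m) :
    Reaches enu b layersProg s (layersCost R (Nat.clog 2 n)) fun s' =>
      (∀ a < 9, s'.nat a = s.nat a) ∧ (∀ a ≤ n, s'.fld a = s.fld a) ∧
      s'.nat 11 = n + 4 + Nat.clog 2 n * R ∧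
      s'.fld (n + 4 + Nat.clog 2 n * R) =
        generator R enu (s.fld n) (fun v => enu (i / T ^ v % T)) (Nat.clog 2 n) iv
          (enu (i / T ^ Nat.clog 2 n % T)) := by
  refine .loop (fun j s' => (∀ a < 9, s'.nat a = s.nat a) ∧ s'.nat 9 = i / T ^ j ∧
    s'.nat 10 = 2 ^ j ∧ s'.nat 11 = n + 4 + j * R ∧ (∀ a ≤ n, s'.fld a = s.fld a) ∧
    ∀ m < R, s'.fld (n + 4 + j * R + m) =
      generator R enu (s.fld n) (fun v => enu (i / T ^ v % T)) j iv
          (enu (i / T ^ j % T) * s.fld n ^ m)) (fun _ => trivial) (by decide) ?_ ?_ ?_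
  · refine ⟨fun _ _ => rfl, by simpa using hi, by simpa using hp, by simpa using hrow,
      fun _ _ => rfl, fun m hm => ?_⟩
    simpa [generator] using hs m hm
  · rintro j hj s₁ ⟨h1, h2, h3, h4, h5, h6⟩
    have e0 : s₁.nat 0 = n := by rw [h1 0 (by omega), hn]
    have e5 : s₁.nat 5 = R := by rw [h1 5 (by omega), hR]
    have e6 : s₁.nat 6 = R * R := by rw [h1 6 (by omega), hQ]
    have e7 : s₁.nat 7 = T := by rw [h1 7 (by omega), hT]
    have e8 : s₁.nat 8 = iv := by rw [h1 8 (by omega), hiv]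
    have hjn : 2 ^ j < n := (Nat.lt_clog_iff_pow_lt one_lt_two).mp hj
    have hrowb : n + 4 + (j + 1) * R ≤ b :=
      (Nat.add_le_add_left (Nat.mul_le_mul_right R hj) _).trans hnb
    have hdiv : i / T ^ j / T = i / T ^ (j + 1) := by rw [Nat.div_div_eq_div_mul, pow_succ]
    refine ⟨by simpa [Test.holds, NExpr.eval, h3, e0] using hjn, ?_⟩
    refine .seq (.setNat 9 (i / T ^ (j + 1)) rfl (by simp [NExpr.eval, NOp.eval, h2, e7, hdiv])
      ((Nat.size_le_size (Nat.div_le_self _ _)).trans hib) (by decide) ?_)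
    refine .seq (.setNat 11 (n + 4 + (j + 1) * R) rfl
      (by simp [NExpr.eval, NOp.eval, h4, e5, add_mul, add_assoc])
      ((size_le_self _).trans hrowb) (by decide) ?_)
    refine .seq (.setFld (n + 3) (enu (i / T ^ (j + 1) % T))
      (by simp [NExpr.eval, NOp.eval, e0]) (by simp [FExpr.eval, NExpr.eval, NOp.eval, e7])
      ?_ (by decide) ?_)
    · simp only [FExpr.EnumLE, NExpr.eval, NOp.eval, State.setN_nat, e7]
      exact (Nat.mod_lt _ hT0).le.trans hTb
    refine .seq ((reaches_rowProg (n := n) (R := R) (iv := iv) (j := j)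
      (row := n + 4 + (j + 1) * R) (by simp [e0]) (by simp [e5]) (by simp [e6]) (by simp [e8])
      (by simp [h3]) (by simp) (by rw [add_mul]; omega) hR0 hQb).mono le_rfl ?_)
    rintro s₂ ⟨g1, g2, g3⟩
    refine .setNat 10 (2 ^ (j + 1)) rfl ?_ ?_ (by decide) ?_
    · simp [NExpr.eval, NOp.eval, g1 10, h3, pow_succ]
    · rw [Nat.size_pow]
      have : Nat.clog 2 n ≤ Nat.clog 2 n * R := Nat.le_mul_of_pos_right _ hR0
      omega
    refine ⟨fun a ha => ?_, ?_, ?_, ?_, fun a ha => ?_, fun m hm => ?_⟩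
    · have i1 : a ≠ 10 := by omega
      have i2 : a ≠ 9 := by omega
      have i3 : a ≠ 11 := by omega
      simp [i1, i2, i3, g1 a (by omega), h1 a ha]
    · simp [g1 9]
    · simp
    · simp [g1 11]
    · have i1 : a ≠ n + 3 := by omega
      simp [g2 a ha, i1, h5 a ha]
    · have i1 : n ≠ n + 3 := by omega
      simp only [State.setN_fld]
      rw [g3 m hm, generator]
      refine Finset.sum_congr rfl fun q _ => ?_
      have hsel : digitSelect R j iv q < R := Nat.mod_lt _ hR0
      have hsub : n + 4 + (j + 1) * R - R = n + 4 + j * R := by rw [add_mul]; omega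
      have i2 : n + 4 + j * R + digitSelect R j iv q ≠ n + 3 := by omega
      rw [hsub]
      simp only [State.setF_fld, if_true, if_neg i1, if_neg i2, State.setN_fld, h5 n le_rfl,
        h6 _ hsel, Algebra.algebraMap_self, RingHom.id_apply]
  · rintro s₁ ⟨h1, h2, h3, h4, h5, h6⟩
    refine ⟨?_, h1, h5, h4, ?_⟩
    · simpa [Test.holds, NExpr.eval, h3, h1 0, hn] using Nat.le_pow_clog one_lt_two n
    · simpa using h6 0 hR0

/-- The cost of `coordsProg` with `l` layers for each of `n` coordinates. -/
def coordsCost {A : Type*} [CommSemiring A] (n R l : A) : A :=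
  1 + (n * (1 + (1 + (1 + (1 + (firstRowCost R + (layersCost R l + (1 + 1)))))) + 1) + 1)

theorem reaches_coordsProg {s : State F} {n R T i : ℕ} (hn : s.nat 0 = n) (hi : s.nat 4 = i)
    (hR : s.nat 5 = R) (hQ : s.nat 6 = R * R) (hT : s.nat 7 = T) (hR0 : 0 < R) (hT0 : 0 < T)
    (hQb : R * R ≤ b) (hTb : T ≤ b) (hib : i.size ≤ b) (hnb : n + 4 + Nat.clog 2 n * R ≤ b) :
    Reaches enu b coordsProg s (coordsCost n R (Nat.clog 2 n)) fun s' =>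
      ∀ a < n, s'.fld a = generator R enu (s.fld n) (fun v => enu (i / T ^ v % T))
        (Nat.clog 2 n) a (enu (i / T ^ Nat.clog 2 n % T)) := by
  refine .seq (.setNat 8 0 rfl rfl (by simp) (by decide) ?_)
  refine .loop (fun u s' => (∀ a < 8, s'.nat a = s.nat a) ∧ s'.nat 8 = u ∧
    s'.fld n = s.fld n ∧ ∀ a < u, s'.fld a = generator R enu (s.fld n)
      (fun v => enu (i / T ^ v % T)) (Nat.clog 2 n) a (enu (i / T ^ Nat.clog 2 n % T)))
      (fun _ => trivial) (by decide) ?_ ?_ ?_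
  · refine ⟨fun a ha => ?_, ?_, ?_, fun a ha => ?_⟩
    · simp [ha.ne]
    · simp
    · simp
    · omega
  · rintro u hu s₁ ⟨h1, h2, h3, h4⟩
    have e0 : s₁.nat 0 = n := by rw [h1 0 (by omega), hn]
    have e4 : s₁.nat 4 = i := by rw [h1 4 (by omega), hi]
    have e5 : s₁.nat 5 = R := by rw [h1 5 (by omega), hR]
    have e6 : s₁.nat 6 = R * R := by rw [h1 6 (by omega), hQ]
    have e7 : s₁.nat 7 = T := by rw [h1 7 (by omega), hT]
    refine ⟨by simpa [Test.holds, NExpr.eval, h2, e0] using hu, ?_⟩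
    refine .seq (.setNat 9 i rfl (by simp [NExpr.eval, e4]) hib (by decide) ?_)
    refine .seq (.setNat 10 1 rfl rfl ((size_le_self _).trans (by omega)) (by decide) ?_)
    refine .seq (.setNat 11 (n + 4) rfl (by simp [NExpr.eval, NOp.eval, e0])
      ((size_le_self _).trans (by omega)) (by decide) ?_)
    refine .seq (.setFld (n + 3) (enu (i % T))
      (by simp [NExpr.eval, NOp.eval, e0]) (by simp [FExpr.eval, NExpr.eval, NOp.eval, e7])
      ?_ (by decide) ?_)
    · simp only [FExpr.EnumLE, NExpr.eval, NOp.eval, State.setN_nat, e7]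
      exact (Nat.mod_lt _ hT0).le.trans hTb
    refine .seq ((reaches_firstRowProg (n := n) (R := R) (row := n + 4) (by simp [e0])
      (by simp [e5]) (by simp) le_rfl (by nlinarith)).mono le_rfl ?_)
    rintro s₂ ⟨g1, g2, g3⟩
    refine .seq ((reaches_layersProg (n := n) (R := R) (T := T) (iv := u) (i := i)
      (by simp [g1 0, e0]) (by simp [g1 5, e5]) (by simp [g1 6, e6]) (by simp [g1 7, e7])
      (by simp [g1 8, h2]) (by simp [g1 9]) (by simp [g1 10]) (by simp [g1 11])
      hR0 hT0 hQb hTb hib hnb (fun m hm => by rw [g3 m hm, g2 n le_rfl]; simp)).mono le_rfl ?_)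
    rintro s₃ ⟨k1, k2, k3, k4⟩
    have f8 : s₃.nat 8 = u := by simp [k1 8, g1 8, h2]
    have hω : s₂.fld n = s.fld n := by simp [g2 n, h3]
    refine .seq (.setFld u (generator R enu (s.fld n) (fun v => enu (i / T ^ v % T))
      (Nat.clog 2 n) u (enu (i / T ^ Nat.clog 2 n % T))) (by simp [NExpr.eval, f8]) ?_ trivial
      (by decide) ?_)
    · simp [FExpr.eval, NExpr.eval, k3, k4, hω]
    refine .setNat 8 (u + 1) rfl (by simp [NExpr.eval, NOp.eval, f8])
      ((size_le_self _).trans (by omega)) (by decide) ?_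
    refine ⟨fun a ha => ?_, ?_, ?_, fun a ha => ?_⟩
    · have i1 : a ≠ 8 := by omega
      have i2 : a ≠ 9 := by omega
      have i3 : a ≠ 10 := by omega
      have i4 : a ≠ 11 := by omega
      simp [i1, i2, i3, i4, k1 a (by omega), g1 a (by omega), h1 a ha]
    · simp
    · have i1 : n ≠ u := by omega
      simp [i1, k2 n, hω]
    · rcases Nat.lt_succ_iff_lt_or_eq.mp ha with ha | rfl
      · have i1 : a ≠ u := by omega
        have i2 : a ≠ n + 3 := by omega
        simp [i1, i2, k2 a (by omega), g2 a (by omega), h4 a ha]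
      · simp
  · rintro s₁ ⟨h1, h2, h3, h4⟩
    exact ⟨by simp [Test.holds, NExpr.eval, h2, h1 0, hn], h4⟩

/-- A product that is nonzero for nonzero elements of order at least `T`. -/
def orderTest (T : ℕ) (w : F) : F := w * ∏ a ∈ Finset.Ico 1 T, (w ^ a - 1)

/-- The cost of `orderProg`. -/
def orderCost {A : Type*} [CommSemiring A] (T : A) : A :=
  1 + (1 + (1 + (T * (1 + (1 + 1) + 1) + 1)))

theorem reaches_orderProg {s : State F} {n T : ℕ} (hn : s.nat 0 = n) (hT : s.nat 7 = T)
    (hT0 : 0 < T) (hTb : T ≤ b) :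
    Reaches enu b orderProg s (orderCost T) fun s' =>
      (∀ a < 9, s'.nat a = s.nat a) ∧ s'.fld n = s.fld n ∧
        s'.fld (n + 1) = orderTest T (s.fld n) := by
  -- The exponents run from `1` to `T - 1`. The count is rounded up to `T` to keep subtraction out
  -- of `orderCost`.
  refine Reaches.mono (m := 1 + (1 + (1 + ((T - 1) * (1 + (1 + 1) + 1) + 1)))) ?_
    (by simp only [orderCost]; gcongr; omega) (fun _ h => h)
  refine .seq (.setFld (n + 1) (s.fld n) (by simp [NExpr.eval, NOp.eval, hn])
    (by simp [FExpr.eval, NExpr.eval, NOp.eval, hn]) trivial (by decide) ?_)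
  refine .seq (.setFld (n + 2) (s.fld n) (by simp [NExpr.eval, NOp.eval, hn])
    (by simp [FExpr.eval, NExpr.eval, NOp.eval, hn]) trivial (by decide) ?_)
  refine .seq (.setNat 9 1 rfl rfl ((size_le_self _).trans (by omega)) (by decide) ?_)
  refine .loop (m := 1 + (1 + 1)) (fun u s' => (∀ a < 9, s'.nat a = s.nat a) ∧ s'.nat 9 = u + 1 ∧
    s'.fld n = s.fld n ∧ s'.fld (n + 1) = orderTest (u + 1) (s.fld n) ∧
    s'.fld (n + 2) = s.fld n ^ (u + 1)) (fun _ => trivial) (by decide) ?_ ?_ ?_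
  · refine ⟨fun a ha => ?_, ?_, ?_, ?_, ?_⟩
    · simp [ha.ne]
    · simp
    · simp
    · simp [orderTest]
    · simp
  · rintro u hu s₁ ⟨h1, h2, h3, h4, h5⟩
    have e0 : s₁.nat 0 = n := by rw [h1 0 (by omega), hn]
    have e7 : s₁.nat 7 = T := by rw [h1 7 (by omega), hT]
    refine ⟨?_, ?_⟩
    · simp only [Test.holds, NExpr.eval, h2, e7]
      omega
    refine .seq (.setFld (n + 1) (orderTest (u + 1 + 1) (s.fld n))
      (by simp [NExpr.eval, NOp.eval, e0]) ?_ ⟨trivial, trivial, trivial⟩ (by decide) ?_)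
    · simp [FExpr.eval, NExpr.eval, NOp.eval, e0, h4, h5, orderTest,
        Finset.prod_Ico_succ_top (show 1 ≤ u + 1 by omega), mul_assoc]
    refine .seq (.setFld (n + 2) (s.fld n ^ (u + 1 + 1))
      (by simp [NExpr.eval, NOp.eval, e0]) ?_ ⟨trivial, trivial⟩ (by decide) ?_)
    · simp [FExpr.eval, NExpr.eval, NOp.eval, e0, h3, h5, pow_succ]
    refine .setNat 9 (u + 1 + 1) rfl (by simp [NExpr.eval, NOp.eval, h2])
      ((size_le_self _).trans (by omega)) (by decide) ?_
    refine ⟨fun a ha => ?_, ?_, ?_, ?_, ?_⟩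
    · simp [ha.ne, h1 a ha]
    · simp
    · simp [h3]
    · simp
    · simp
  · rintro s₁ ⟨h1, h2, h3, h4, h5⟩
    have hTT : T - 1 + 1 = T := by omega
    rw [hTT] at h2 h4
    exact ⟨by simp [Test.holds, NExpr.eval, h2, h1 7, hT], h1, h3, h4⟩

/-- The cost of `searchProg` with `N` iterations. -/
def searchCost {A : Type*} [CommSemiring A] (T N : A) : A :=
  N * (1 + (orderCost T + 1) + 1) + 1

theorem reaches_searchProg {s : State F} {n T c : ℕ} (hn : s.nat 0 = n) (hT : s.nat 7 = T)
    (h8 : s.nat 8 = 0) (hf : s.fld (n + 1) = 0) (hT0 : 0 < T) (hTb : T ≤ b) (hcb : c + 1 ≤ b)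
    (hc : orderTest T (enu c) ≠ 0) (hmin : ∀ c' < c, orderTest T (enu c') = 0) :
    Reaches enu b searchProg s (searchCost T (c + 1)) fun s' =>
      (∀ a < 8, s'.nat a = s.nat a) ∧ s'.fld n = enu c := by
  refine .loop (fun u s' => (∀ a < 8, s'.nat a = s.nat a) ∧ s'.nat 8 = u ∧
    (u = 0 → s'.fld (n + 1) = 0) ∧
    ∀ v, u = v + 1 → s'.fld n = enu v ∧ s'.fld (n + 1) = orderTest T (enu v))
    (fun _ => ⟨trivial, trivial⟩) (by decide) ?_ ?_ ?_
  · exact ⟨fun _ _ => rfl, h8, fun _ => hf, fun v hv => by omega⟩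
  · rintro u hu s₁ ⟨h1, h2, h3, h4⟩
    have e0 : s₁.nat 0 = n := by rw [h1 0 (by omega), hn]
    have e7 : s₁.nat 7 = T := by rw [h1 7 (by omega), hT]
    refine ⟨?_, ?_⟩
    · simp only [Test.holds, FExpr.eval, NExpr.eval, NOp.eval, e0]
      rcases u with - | v
      · exact h3 rfl
      · rw [(h4 v rfl).2]
        exact hmin v (by omega)
    refine .seq (.setFld n (enu u) (by simp [NExpr.eval, NOp.eval, e0])
      (by simp [FExpr.eval, NExpr.eval, h2]) ?_ (by decide) ?_)
    · simp only [FExpr.EnumLE, NExpr.eval, h2]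
      omega
    refine .seq ((reaches_orderProg (n := n) (T := T) (by simp [e0]) (by simp [e7]) hT0
      hTb).mono le_rfl ?_)
    rintro s₂ ⟨g1, g2, g3⟩
    refine .setNat 8 (u + 1) rfl (by simp [NExpr.eval, NOp.eval, g1 8, h2])
      ((size_le_self _).trans (by omega)) (by decide) ?_
    refine ⟨fun a ha => ?_, ?_, fun h => by omega, fun v hv => ?_⟩
    · simp [ha.ne, g1 a (by omega), h1 a ha]
    · simp
    · obtain rfl : u = v := by omega
      simp [g2, g3]
  · rintro s₁ ⟨h1, h2, h3, h4⟩
    refine ⟨?_, h1, (h4 c rfl).1⟩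
    simp only [Test.holds, FExpr.eval, NExpr.eval, NOp.eval, h1 0 (by omega), hn]
    rw [(h4 c rfl).2]
    exact hc

/-- The number of steps of `hittingProg`. -/
def hittingCost {A : Type*} [CommSemiring A] (n R T N l : A) : A :=
  1 + (1 + (1 + (searchCost T N + coordsCost n R l)))

theorem computes_hittingProg {n k e d i R T c : ℕ} (hR : R = k * e) (hT : T = d * e * (R * R))
    (hR0 : 0 < R) (hT0 : 0 < T) (hkb : k ≤ b) (heb : e ≤ b) (hdb : d ≤ b)
    (hQb : R * R ≤ b) (hTb : T ≤ b) (hcb : c + 1 ≤ b) (hib : i.size ≤ b)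
    (hnb : n + 4 + Nat.clog 2 n * R ≤ b)
    (hc : orderTest T (enu c) ≠ 0) (hmin : ∀ c' < c, orderTest T (enu c') = 0) :
    Computes enu hittingProg [n, k, e, d, i]
      (fun m : Fin n => generator R enu (enu c) (fun v => enu (i / T ^ v % T)) (Nat.clog 2 n) m
        (enu (i / T ^ Nat.clog 2 n % T)))
      (hittingCost n R T (c + 1) (Nat.clog 2 n) * stepCost b) := by
  have hbounded : (start [n, k, e, d, i] : State F).Bounded b := by
    intro a
    have hs := fun x => size_le_self x
    match a with
    | 0 => exact (hs n).trans (by omega)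
    | 1 => exact (hs k).trans hkb
    | 2 => exact (hs e).trans heb
    | 3 => exact (hs d).trans hdb
    | 4 => exact hib
    | a + 5 => simp [start]
  have hreach : Reaches enu b hittingProg (start [n, k, e, d, i])
      (hittingCost n R T (c + 1) (Nat.clog 2 n)) fun s' => ∀ a < n, s'.fld a =
        generator R enu (enu c) (fun v => enu (i / T ^ v % T)) (Nat.clog 2 n) a
          (enu (i / T ^ Nat.clog 2 n % T)) := by
    refine .seq (.setNat 5 R rfl (by simp [NExpr.eval, NOp.eval, start, hR])
      ((size_le_self _).trans (by nlinarith)) (by decide) ?_)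
    refine .seq (.setNat 6 (R * R) rfl (by simp [NExpr.eval, NOp.eval])
      ((size_le_self _).trans hQb) (by decide) ?_)
    refine .seq (.setNat 7 T rfl (by simp [NExpr.eval, NOp.eval, start, hT])
      ((size_le_self _).trans hTb) (by decide) ?_)
    refine .seq ((reaches_searchProg (n := n) (T := T) (c := c) (by simp [start]) (by simp)
      (by simp [start]) rfl hT0 hTb hcb hc hmin).mono le_rfl ?_)
    rintro s ⟨h1, h2⟩
    refine (reaches_coordsProg (n := n) (R := R) (T := T) (i := i) (by simp [h1 0, start])
      (by simp [h1 4, start]) (by simp [h1 5]) (by simp [h1 6]) (by simp [h1 7]) hR0 hT0 hQb hTb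
      hib hnb).mono le_rfl ?_
    intro s' hs'
    rwa [h2] at hs'
  obtain ⟨t, s', he, ht, -, hQ⟩ := hreach hbounded
  exact ⟨t, s', he, by simpa using ht, fun m => hQ m m.2⟩

end

end FieldRAM

/-! ### Elements of large order, digits, and the final assembly -/

namespace FieldRAM

/-- A coincidence `w ^ a = w ^ c` with `a < c < T` gives `w ^ (c - a) = 1`, which kills a factor of
the test. -/
theorem injOn_pow_of_orderTest_ne_zero {F : Type*} [Field F] {T : ℕ} {w : F}
    (h : orderTest T w ≠ 0) : Set.InjOn (fun a : ℕ => w ^ a) (Set.Iio T) := by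
  have hw : w ≠ 0 := left_ne_zero_of_mul h
  have hp := Finset.prod_ne_zero_iff.mp (right_ne_zero_of_mul h)
  have key : ∀ a c : ℕ, a < c → c < T → w ^ a ≠ w ^ c := by
    intro a c hac hc hEq
    refine hp (c - a) (Finset.mem_Ico.mpr (by omega)) (sub_eq_zero.mpr ?_)
    rw [← Nat.add_sub_of_le hac.le, pow_add] at hEq
    exact (mul_left_cancel₀ (pow_ne_zero a hw) (by rw [mul_one]; exact hEq)).symm
  intro a ha c hc hac
  rcases lt_trichotomy a c with hlt | heq | hlt
  · exact absurd hac (key a c hlt hc)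
  · exact heq
  · exact absurd hac.symm (key c a hlt ha)

-- The test is a nonzero polynomial in `w` of degree at most `1 + (T - 1) * T ≤ T * T`, so it cannot
-- vanish at `T * T + 1` distinct elements.
open Polynomial in
theorem exists_orderTest_ne_zero {F : Type*} [Field F] {enu : ℕ → F} {T : ℕ} (hT : 0 < T)
    (henu : Set.InjOn enu (Set.Iio (T * T + 1))) : ∃ c < T * T + 1, orderTest T (enu c) ≠ 0 := by
  classical
  by_contra! hall
  set p : F[X] := X * ∏ a ∈ Finset.Ico 1 T, (X ^ a - C 1) with hp
  have hp0 : p ≠ 0 := mul_ne_zero X_ne_zero (Finset.prod_ne_zero_iff.mpr fun a ha =>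
    X_pow_sub_C_ne_zero (Finset.mem_Ico.mp ha).1 1)
  have hdeg : p.natDegree ≤ T * T := by
    have h1 : (∏ a ∈ Finset.Ico 1 T, (X ^ a - C (1 : F))).natDegree ≤ (T - 1) * T := by
      refine (natDegree_prod_le _ _).trans ((Finset.sum_le_card_nsmul _ _ T fun a ha => ?_).trans
        (by simp))
      rw [natDegree_X_pow_sub_C]
      exact (Finset.mem_Ico.mp ha).2.le
    obtain ⟨T, rfl⟩ : ∃ T', T = T' + 1 := ⟨T - 1, by omega⟩
    refine natDegree_mul_le.trans ?_
    rw [natDegree_X]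
    rw [Nat.add_sub_cancel] at h1
    nlinarith
  refine hp0 (eq_zero_of_natDegree_lt_card_of_eval_eq_zero' p
    ((Finset.range (T * T + 1)).image enu) ?_ ?_)
  · intro x hx
    obtain ⟨c, hc, rfl⟩ := Finset.mem_image.mp hx
    have := hall c (Finset.mem_range.mp hc)
    simpa [orderTest, hp, eval_prod] using this
  · rw [Finset.card_image_of_injOn (fun x hx y hy h => henu (by simpa using hx) (by simpa using hy) h),
      Finset.card_range]
    omega

theorem exists_digits {T : ℕ} (a : ℕ → ℕ) (N : ℕ) (ha : ∀ v < N, a v < T) :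
    ∃ i < T ^ N, ∀ v < N, i / T ^ v % T = a v := by
  induction N generalizing a with
  | zero => exact ⟨0, by simp, fun v hv => by omega⟩
  | succ N ih =>
    obtain ⟨i, hi, hd⟩ := ih (fun v => a (v + 1)) fun v hv => ha (v + 1) (by omega)
    have h0 := ha 0 (by omega)
    refine ⟨T * i + a 0, ?_, fun v hv => ?_⟩
    · rw [pow_succ]
      nlinarith
    · rcases v with - | v
      · simp [Nat.mod_eq_of_lt h0]
      · rw [pow_succ', ← Nat.div_div_eq_div_mul, Nat.mul_add_div (by omega), Nat.div_eq_of_lt h0,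
          add_zero]
        exact hd v (by omega)

/-- A bound for the length of all numbers that occur in the run of `hittingProg`. -/
def lengthBound {A : Type*} [CommSemiring A] (n T : A) : A := (n + 5) * (T + 1) ^ 2

/-- A bound for the running time of `hittingProg`. -/
def runtime {A : Type*} [CommSemiring A] (n k e d : A) : A :=
  hittingCost n (k * e) (d * e * (k * e * (k * e)))
    (d * e * (k * e * (k * e)) * (d * e * (k * e * (k * e))) + 1) n *
    (100000 * (lengthBound n (d * e * (k * e * (k * e))) + 1) ^ 2)

/-- The cost functions are defined over every commutative semiring, so one expression is both the
number and the polynomial `p`. -/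
theorem eval_runtime (n k e d : ℕ) :
    MvPolynomial.eval ![n, k, e, d] (runtime (MvPolynomial.X 0) (MvPolynomial.X 1)
      (MvPolynomial.X 2) (MvPolynomial.X 3) : MvPolynomial (Fin 4) ℕ) = runtime n k e d := by
  simp [runtime, hittingCost, searchCost, orderCost, coordsCost, firstRowCost, layersCost,
    rowCost, entryCost, lengthBound]

/-- Replaces the search length and `⌈lg n⌉`, which are not polynomials in the parameters, by `T * T
+ 1` and `n`. -/
theorem hittingCost_mono (n R T : ℕ) {N N' l l' : ℕ} (hN : N ≤ N') (hl : l ≤ l') :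
    hittingCost n R T N l ≤ hittingCost n R T N' l' := by
  unfold hittingCost searchCost coordsCost layersCost
  gcongr

end FieldRAM

open FieldRAM in
theorem mainTheorem6 :
    ∃ (prog : FieldRAM.Prog) (p : MvPolynomial (Fin 4) ℕ),
      ∀ (F : Type*) [Field F] (enu : ℕ → F), IsEnumeration enu →
      ∀ n k e d : ℕ, 0 < n → 0 < d →
        (((2 * n * d * k ^ 3 * e ^ 4) ^ 2 : ℕ) : ℕ∞) ≤ ENat.card F →
        ∃ (size : ℕ) (h : Fin size → (Fin n → F)),
          size ≤ (2 * n * d ^ 2 * k ^ 4 * e ^ 6) ^ (Nat.clog 2 n + 1) ∧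
          IsHittingSet (diagonalClass F n k e d) (Set.range h) ∧
          ∀ i : Fin size,
            FieldRAM.Computes enu prog [n, k, e, d, (i : ℕ)] (h i)
              (MvPolynomial.eval ![n, k, e, d] p) := by
  refine ⟨hittingProg, runtime (MvPolynomial.X 0) (MvPolynomial.X 1)
      (MvPolynomial.X 2) (MvPolynomial.X 3), fun F _ enu henu n k e d hn hd hcard => ?_⟩
  rw [eval_runtime]
  rcases Nat.eq_zero_or_pos k with rfl | hk
  · refine ⟨0, Fin.elim0, Nat.zero_le _, ?_, fun i => i.elim0⟩
    rintro f ⟨Φ, -, -, rfl⟩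
    simp [DiagonalCircuit.toPoly]
  -- Since `k > 0` and each `expoSize` is at least `1`, the class is empty for `e = 0`.
  rcases Nat.eq_zero_or_pos e with rfl | he
  · refine ⟨0, Fin.elim0, Nat.zero_le _, ?_, fun i => i.elim0⟩
    rintro f ⟨Φ, hΦ, -, -⟩
    exact absurd (Φ.sum_lt_of_expoSize_le hΦ ⟨⟨0, hk⟩, fun _ => 0⟩) (by simp)
  set R := k * e with hR
  set T := d * e * (R * R) with hT
  have hR0 : 0 < R := Nat.mul_pos hk he
  have hQ0 : 0 < R * R := Nat.mul_pos hR0 hR0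
  have hT0 : 0 < T := Nat.mul_pos (Nat.mul_pos hd he) hQ0
  have hQT : R * R ≤ T := Nat.le_mul_of_pos_left _ (Nat.mul_pos hd he)
  have hRQ : R ≤ R * R := Nat.le_mul_of_pos_left _ hR0
  have hinj : Set.InjOn enu (Set.Iio (T * T + 1)) := by
    refine henu.mono fun i hi => ?_
    have h1 : i < T * T + 1 := hi
    -- The assumed bound is the square of `T * (2 * n * k * e)`, hence at least `4 * T ^ 2`.
    have h2 : T * T + 1 ≤ (2 * n * d * k ^ 3 * e ^ 4) ^ 2 := by
      have h3 : 2 * n * d * k ^ 3 * e ^ 4 = T * (2 * (n * k * e)) := by rw [hT, hR]; ring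
      have h4 : 0 < n * k * e := Nat.mul_pos (Nat.mul_pos hn hk) he
      have h5 : T * 2 ≤ T * (2 * (n * k * e)) := Nat.mul_le_mul_left _ (by omega)
      rw [h3]
      nlinarith [Nat.pow_le_pow_left h5 2, Nat.mul_pos hT0 hT0]
    exact lt_of_lt_of_le (by exact_mod_cast h1.trans_le h2) hcard
  -- The least such `c` is taken because the search stops there.
  obtain ⟨c, ⟨hcT, hc⟩, hmin⟩ : ∃ c, (c < T * T + 1 ∧ orderTest T (enu c) ≠ 0) ∧
      ∀ c' < c, orderTest T (enu c') = 0 := by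
    classical
    have hex := exists_orderTest_ne_zero hT0 hinj
    refine ⟨Nat.find hex, Nat.find_spec hex, fun c' hc' => ?_⟩
    by_contra hne
    exact Nat.find_min hex hc' ⟨hc'.trans (Nat.find_spec hex).1, hne⟩
  have hinjT : Set.InjOn enu (Set.Iio T) := hinj.mono (Set.Iio_subset_Iio (by nlinarith))
  have hL : Nat.clog 2 n ≤ n := Nat.clog_le_of_le_pow n.lt_two_pow_self.le
  refine ⟨T ^ (Nat.clog 2 n + 1), fun i m => generator R enu (enu c)
    (fun v => enu (i / T ^ v % T)) (Nat.clog 2 n) m (enu (i / T ^ Nat.clog 2 n % T)), ?_, ?_, ?_⟩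
  · refine Nat.pow_le_pow_left ?_ _
    have h1 : 2 * n * d ^ 2 * k ^ 4 * e ^ 6 = T * (2 * n * T) := by rw [hT, hR]; ring
    rw [h1]
    exact Nat.le_mul_of_pos_right _ (by positivity)
  · rintro f ⟨Φ, hΦe, hΦd, rfl⟩
    refine ⟨fun h a _ => by rw [h, map_zero], fun h => ?_⟩
    by_contra hne
    have hcardR : Fintype.card Φ.SubExpo ≤ R := by
      rw [Φ.card_subExpo]
      exact (Finset.sum_le_card_nsmul _ _ e fun i _ => hΦe i).trans (by simp [hR])
    obtain ⟨a, ha, hev⟩ := Φ.exists_grid_seed_eval_ne_zero hΦe hΦd hR0 hd hcardR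
      (hinjT.mono (Set.Iio_subset_Iio hQT)) hinjT (injOn_pow_of_orderTest_ne_zero hc)
      (Nat.le_pow_clog one_lt_two n) hne
    -- The good grid seed, read as base `T` digits, is the index of the point that hits the circuit.
    obtain ⟨i, hi, hia⟩ := exists_digits a (Nat.clog 2 n + 1) fun v hv => ha v (by omega)
    refine hev ?_
    rw [← h _ ⟨⟨i, hi⟩, rfl⟩]
    congr 2
    funext m
    dsimp only
    rw [hia _ (Nat.lt_succ_self _)]
    exact generator_congr R enu (enu c) _ m (fun v hv => by rw [hia v (by omega)]) _
  · intro i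
    have hb1 : ∀ x, x ≤ (n + 5) * (T + 1) → x ≤ lengthBound n T := fun x hx => hx.trans (by
      rw [lengthBound]
      exact Nat.mul_le_mul_left _ (Nat.le_self_pow two_ne_zero _))
    have hb2 : ∀ x, x ≤ T → x ≤ lengthBound n T := fun x hx => hb1 x (by nlinarith)
    have hkR : k ≤ R := Nat.le_mul_of_pos_right _ he
    have heR : e ≤ R := Nat.le_mul_of_pos_left _ hk
    have hdT : d ≤ T := by
      rw [hT, mul_assoc]
      exact Nat.le_mul_of_pos_right _ (Nat.mul_pos he hQ0)
    -- The index `i` need not be polynomially bounded, but its length is at most `T * (⌈lg n⌉ + 1)`.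
    have hsize : Nat.size i ≤ lengthBound n T := by
      refine hb1 _ (Nat.size_le.mpr (i.2.trans_le ?_))
      calc T ^ (Nat.clog 2 n + 1) ≤ (2 ^ T) ^ (Nat.clog 2 n + 1) :=
            Nat.pow_le_pow_left T.lt_two_pow_self.le _
        _ = 2 ^ (T * (Nat.clog 2 n + 1)) := (pow_mul ..).symm
        _ ≤ 2 ^ ((n + 5) * (T + 1)) := Nat.pow_le_pow_right two_pos (by nlinarith)
    have hcompute := computes_hittingProg (enu := enu) (b := lengthBound n T) (n := n) (i := i)
      hR hT hR0 hT0 (hb2 _ (by omega)) (hb2 _ (by omega)) (hb2 _ hdT) (hb2 _ hQT) (hb2 _ le_rfl)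
      (show c + 1 ≤ lengthBound n T by rw [lengthBound]; nlinarith) hsize
      (hb1 _ (by nlinarith [Nat.mul_le_mul hL (hRQ.trans hQT)])) hc hmin
    obtain ⟨t, s, hex, ht, hs⟩ := hcompute
    exact ⟨t, s, hex, ht.trans (Nat.mul_le_mul_right _
      (hittingCost_mono n R T (Nat.succ_le_of_lt hcT) hL)), hs⟩
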